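/- Let $z\in\mathbb C\setminus(-\infty,1]$ and let $0\le m\le n$ be integers. All powers and logarithms below are taken with $-\pi<\arg(z\pm1)<\pi$; so $\ln\frac{z+1}{z-1}$ and powers of $\frac{z+1}{z-1}$, $\frac{z-1}{z+1}$ are principal, and $\left(\frac{z^2-1}{4}\right)^{m/2}$ means $\left(\frac{z-1}{2}\right)^{m/2}\left(\frac{z+1}{2}\right)^{m/2}$ with principal powers. Let $\psi=\Gamma'/\Gamma$, and let $$P_\nu^\mu(z)=\left(\frac{z+1}{z-1}\right)^{\mu/2}\frac{1}{\Gamma(1-\mu)}\,{}_2F_1\!\left(-\nu,\nu+1;1-\mu;\frac{1-z}{2}\right)\qquad(\nu,\mu\in\mathbb C)$$ be Hobson's associated Legendre function of the first kind, where ${}_2F_1(a,b;c;w)/\Gamma(c)$ denotes the analytic continuation to $\mathbb C\setminus[1,\infty)$ of $\sum_{k\ge0}\frac{(a)_k(b)_k}{\Gamma(c+k)\,k!}w^k$ (with $1/\Gamma=0$ at the poles of $\Gamma$). Let $Q_\nu^\mu$ be Hobson's associated Legendre function of the second kind, $$Q_\nu^\mu(z)=\frac{\pi}{2}\,\mathrm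 e^{\mathrm i\pi\mu}\,\frac{\mathrm e^{\mp\mathrm i\pi\nu}P_\nu^\mu(z)-P_\nu^\mu(-z)}{\sin[\pi(\nu+\mu)]}\qquad(\operatorname{Im}z\gtrless0),$$ where for $\nu=n$, $\mu=m$ the right-hand side is understood as its limit for $\nu\to n$ with $\mu=m$ fixed, and where $Q_n^m$ is extended to $z\in(1,\infty)$ as the limit from non-real points. Then these limits exist, $Q_n^m$ is at every $z\in\mathbb C\setminus(-\infty,1]$ the limit of its values at non-real points, and, both with all upper signs and with all lower signs, $$\begin{aligned} Q_n^m(z)={}&\frac12P_n^m(z)\ln\frac{z+1}{z-1}\mp\frac12\left[\psi(n+1)+\psi(n-m+1)\right]P_n^m(z)\\ &\pm\frac{(\pm1)^n(-1)^m}{2}\left(\frac{z\pm1}{z\mp1}\right)^{m/2}\sum_{k=0}^{m-1}(\mp1)^k\frac{(k+n)!\,(m-k-1)!}{k!\,(n-k)!}\left(\frac{z\mp1}{2}\right)^k\\ &\mp\frac{(\pm1)^{n+m}}{2}\left(\frac{z^2-1}{4}\right)^{m/2}\sum_{k=0}^{n-m}(\pm1)^k\frac{(k+n+m)!}{k!\,(k+m)!\,(n-m-k)!}\left[\psi(k+n+m+1)-\psi(k+m+1)-\psi(k+1)\right]\left(\frac{z\mp1}{2}\right)^k\\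 &\pm\frac{(\pm1)^n}{2}\frac{(n+m)!}{(n-m)!}\left(\frac{z\mp1}{z\pm1}\right)^{m/2}\sum_{k=0}^{n}(\pm1)^k\frac{(k+n)!\,\psi(k+n+1)}{k!\,(k+m)!\,(n-k)!}\left(\frac{z\mp1}{2}\right)^k, \end{aligned}$$ where an empty sum is zero. -/

import Mathlib

open Filter Topology

/-- `f` is the analytic continuation, to the cut plane `ℂ \ [1, ∞)`, of the regularized Gauss series
`∑ (a)_k (b)_k / (Γ(c + k) k!) w ^ k`, `‖w‖ < 1`. (Mathlib's series uses `1 / Γ = 0` at the poles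
of `Γ`, as it should.) -/
def IsGaussContinuation (a b c : ℂ) (f : ℂ → ℂ) : Prop :=
  DifferentiableOn ℂ f {w : ℂ | 1 - w ∈ Complex.slitPlane} ∧
    ∀ w : ℂ, ‖w‖ < 1 → f w = Complex.regularizedGaussHGFun a b c w

/-- Two continuations agree on the cut plane (which is star-shaped, hence connected). -/
theorem IsGaussContinuation.eqOn {a b c : ℂ} {f g : ℂ → ℂ}
    (hf : IsGaussContinuation a b c f) (hg : IsGaussContinuation a b c g) :
    Set.EqOn f g {w : ℂ | 1 - w ∈ Complex.slitPlane} := by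
  have hopen : IsOpen {w : ℂ | 1 - w ∈ Complex.slitPlane} :=
    Complex.isOpen_slitPlane.preimage (continuous_const.sub continuous_id)
  have himg : {w : ℂ | 1 - w ∈ Complex.slitPlane} = (fun w => 1 - w) '' Complex.slitPlane := by
    ext w
    constructor
    · intro h
      exact ⟨1 - w, h, by ring⟩
    · rintro ⟨v, hv, rfl⟩
      simpa using hv
  have hconn : IsPreconnected {w : ℂ | 1 - w ∈ Complex.slitPlane} := by
    rw [himg]
    exact (Complex.starConvex_one_slitPlane.isPathConnected
      Complex.one_mem_slitPlane).isConnected.isPreconnected.image _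
      (continuous_const.sub continuous_id).continuousOn
  refine (hf.1.analyticOnNhd hopen).eqOn_of_preconnected_of_eventuallyEq
    (hg.1.analyticOnNhd hopen) hconn (z₀ := 0) (by simp) ?_
  filter_upwards [Metric.ball_mem_nhds (0 : ℂ) one_pos] with w hw
  have hw' : ‖w‖ < 1 := by simpa using hw
  rw [hf.2 w hw', hg.2 w hw']

open Classical in
/-- The regularized Gauss function `₂F₁(a, b; c; w) / Γ(c)` on the cut plane `ℂ \ [1, ∞)`. -/
noncomputable def gaussRegularized (a b c w : ℂ) : ℂ :=
  if h : ∃ f : ℂ → ℂ, IsGaussContinuation a b c f then h.choose w else 0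

/-- Hobson's associated Legendre function of the first kind, on the plane cut along `(-∞, 1]`:
`P_ν^μ(z) = ((z + 1) / (z - 1)) ^ (μ / 2) ₂F₁(-ν, ν + 1; 1 - μ; (1 - z) / 2) / Γ(1 - μ)`.
On the cut plane `(z + 1) / (z - 1)` is never in `(-∞, 0]`, and the principal power is the one with
`-π < arg (z ± 1) < π`. -/
noncomputable def hobsonP (ν μ z : ℂ) : ℂ :=
  ((z + 1) / (z - 1)) ^ (μ / 2) * gaussRegularized (-ν) (ν + 1) (1 - μ) ((1 - z) / 2)

/-- The connection formula
`(π / 2) e^{iπμ} (e^{∓iπν} P_ν^μ(z) - P_ν^μ(-z)) / sin (π (ν + μ))`, upper sign for `Im z > 0`,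
lower sign for `Im z < 0`; it is meant for `Im z ≠ 0` and `ν + μ` not an integer. -/
noncomputable def hobsonQGeneric (ν μ z : ℂ) : ℂ :=
  (Real.pi / 2 : ℂ) * Complex.exp (Complex.I * Real.pi * μ) *
    (Complex.exp ((if 0 < z.im then -1 else 1) * Complex.I * Real.pi * ν) * hobsonP ν μ z
      - hobsonP ν μ (-z)) / Complex.sin (Real.pi * (ν + μ))

open Classical in
/-- Hobson's associated Legendre function of the second kind for `Im z ≠ 0`: given by the connection
formula, and by its limit in the degree (at fixed order) where the denominator vanishes. -/
noncomputable def hobsonQOffAxis (ν μ z : ℂ) : ℂ :=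
  if Complex.sin (Real.pi * (ν + μ)) = 0 then
    limUnder (𝓝[≠] ν) (fun ν' => hobsonQGeneric ν' μ z)
  else hobsonQGeneric ν μ z

open Classical in
/-- Hobson's associated Legendre function of the second kind `Q_ν^μ(z)` on the plane cut along
`(-∞, 1]`; its values on `(1, ∞)` are the limits from the points off the real axis. -/
noncomputable def hobsonQ (ν μ z : ℂ) : ℂ :=
  if z.im = 0 then limUnder (𝓝[{w : ℂ | w.im ≠ 0}] z) (hobsonQOffAxis ν μ)
  else hobsonQOffAxis ν μ z

/-! At ν = n the connection formula is of the form 0/0: the denominator has a simple zero, and the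
numerator vanishes because P_n^m(-z) = (-1)^n P_n^m(z) (`hobsonP_neg`). The limit is a quotient of
derivatives. With a dot for ∂/∂ν at ν = n, and s = -1 or 1 for Im z > 0 or Im z < 0, it is sπi/2 ·
P(z) + 1/2 · Ṗ(z) - (-1)^n/2 · Ṗ(-z) (`tendsto_hobsonQGeneric`). Everything rests on Ṗ.

Put w = (1 - z)/2. The first m coefficients of the regularized series vanish, which leaves w^m λ(ν)
F(m - ν, ν + m + 1; m + 1; w) with λ = `leadCoeff m`. The sum of the upper parameters does not
depend on ν, so F depends on ν only through their product σ. The substitution w = 4ρ/(1 + ρ)^2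
carries ℂ \ [1, ∞) to the unit disc. There F is one power series in ρ whose coefficients are entire
in σ, with polynomial growth locally uniform in σ. Hence ∂F/∂σ exists on the whole cut plane and is
holomorphic in w.

Differentiating the hypergeometric equation in ν gives an inhomogeneous equation, whose power series
solution is fixed by its constant term. The recurrence ψ(x + 1) = ψ(x) + 1/x exhibits that solution:
(1 - w)^m ∂_ν(λF) = Y log(1 - w) + V with polynomials Y and V (`one_sub_pow_mul_reducedGaussDeriv`).
V is found in powers of w and again in powers of 1 - w (`degreeDerivPoly_eq_comp`). The first form
serves Ṗ(z), the second Ṗ(-z), so that both are expanded in (1 - z)/2. The term sπi/2 · P turns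
log((1 - z)/2) into log((z - 1)/2), and the upper-sign formula results (`hobsonQLim_eq_hobsonQRep`).
The parity Q(-z) = -(-1)^n Q(z) off the real axis gives the lower signs, and continuity of the
right-hand sides gives the values on (1, ∞). -/

section

/-! ### Convergent power series and termwise operations -/

open PowerSeries in
/-- The power series `φ` converges to `g` on the open disc of radius `R` around `0`. -/
def HasPowerSum (φ : PowerSeries ℂ) (R : ℝ) (g : ℂ → ℂ) : Prop :=
  ∀ x : ℂ, ‖x‖ < R → HasSum (fun k => coeff k φ * x ^ k) (g x)

namespace HasPowerSum

open PowerSeries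

variable {φ ψ : PowerSeries ℂ} {R : ℝ} {g h : ℂ → ℂ}

theorem congr (hφ : HasPowerSum φ R g) (hgh : ∀ x, ‖x‖ < R → g x = h x) : HasPowerSum φ R h :=
  fun x hx => hgh x hx ▸ hφ x hx

theorem mono {r : ℝ} (hφ : HasPowerSum φ R g) (hr : r ≤ R) : HasPowerSum φ r g :=
  fun x hx => hφ x (hx.trans_le hr)

theorem add (hφ : HasPowerSum φ R g) (hψ : HasPowerSum ψ R h) :
    HasPowerSum (φ + ψ) R (fun x => g x + h x) := fun x hx => by
  simpa [add_mul] using (hφ x hx).add (hψ x hx)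

theorem C_mul (a : ℂ) (hφ : HasPowerSum φ R g) :
    HasPowerSum (C a * φ) R (fun x => a * g x) := fun x hx => by
  simpa [coeff_C_mul, mul_assoc] using (hφ x hx).mul_left a

theorem X_mul (hφ : HasPowerSum φ R g) :
    HasPowerSum (X * φ) R (fun x => x * g x) := fun x hx => by
  rw [← hasSum_nat_add_iff' 1]
  have h := (hφ x hx).mul_left x
  simp only [Finset.range_one, Finset.sum_singleton, pow_zero, mul_one, coeff_zero_X_mul, sub_zero,
    coeff_succ_X_mul]
  refine h.congr_fun fun k => ?_
  ring

theorem poly_mul (p : Polynomial ℂ) (hφ : HasPowerSum φ R g) :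
    HasPowerSum ((p : PowerSeries ℂ) * φ) R (fun x => p.eval x * g x) := by
  induction p using Polynomial.induction_on' with
  | add p q hp hq =>
    simpa [add_mul] using hp.add hq
  | monomial n a =>
    induction n with
    | zero => simpa using hφ.C_mul a
    | succ n ih =>
      have := ih.X_mul
      have e : ((Polynomial.monomial (n + 1) a : Polynomial ℂ) : PowerSeries ℂ) * φ
          = X * (((Polynomial.monomial n a : Polynomial ℂ) : PowerSeries ℂ) * φ) := by
        rw [← mul_assoc, ← Polynomial.coe_X, ← Polynomial.coe_mul, Polynomial.X_mul_monomial]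
      rw [e]
      refine this.congr fun x _ => ?_
      simp only [Polynomial.eval_monomial]
      ring

theorem summable_norm (hφ : HasPowerSum φ R g) {r : ℝ} (h0 : 0 ≤ r) (hr : r < R) :
    Summable fun k => ‖coeff k φ‖ * r ^ k := by
  have := (hφ (r : ℂ) (by simpa [abs_of_nonneg h0] using hr)).summable.norm
  simpa [abs_of_nonneg h0] using this

/-- Termwise differentiation by Weierstrass' theorem on a disc of radius r with ‖x‖ < r < R, where
the absolute values of the terms at r form a summable majorant. -/
theorem differentiableAt_and_hasSum_deriv (hφ : HasPowerSum φ R g) {x : ℂ} (hx : ‖x‖ < R) :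
    DifferentiableAt ℂ g x ∧ HasSum (fun k => coeff k (d⁄dX ℂ φ) * x ^ k) (deriv g x) := by
  obtain ⟨r, hxr, hrR⟩ := exists_between hx
  have hr0 : 0 ≤ r := (norm_nonneg x).trans hxr.le
  have hU : IsOpen (Metric.ball (0 : ℂ) r) := Metric.isOpen_ball
  have hxU : x ∈ Metric.ball (0 : ℂ) r := by simpa using hxr
  have hd : ∀ k, DifferentiableOn ℂ (fun y : ℂ => coeff k φ * y ^ k) (Metric.ball 0 r) :=
    fun k => (Differentiable.const_mul (differentiable_id.pow k) _).differentiableOn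
  have hb : ∀ (k : ℕ) (y : ℂ), y ∈ Metric.ball (0 : ℂ) r →
      ‖coeff k φ * y ^ k‖ ≤ ‖coeff k φ‖ * r ^ k := by
    intro k y hy
    rw [norm_mul, norm_pow]
    have : ‖y‖ ≤ r := by simpa using (Metric.mem_ball.1 hy).le
    gcongr
  have hs := hφ.summable_norm hr0 hrR
  have heq : g =ᶠ[𝓝 x] fun y => ∑' k, coeff k φ * y ^ k := by
    filter_upwards [hU.mem_nhds hxU] with y hy
    exact ((hφ y ((by simpa using hy : ‖y‖ < r).trans hrR)).tsum_eq).symm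
  have h1 := Complex.differentiableOn_tsum_of_summable_norm hs hd hU hb
  have h2 := Complex.hasSum_deriv_of_summable_norm hs hd hU hb hxU
  refine ⟨(heq.differentiableAt_iff).2 (h1.differentiableAt (hU.mem_nhds hxU)), ?_⟩
  rw [heq.deriv_eq]
  -- The derivative of the constant term is zero; dropping it shifts the index to that of the formal
  -- derivative.
  rw [← hasSum_nat_add_iff' 1] at h2
  simp at h2
  refine h2.congr_fun fun k => ?_
  simp [coeff_derivative]
  ring

theorem derivative (hφ : HasPowerSum φ R g) : HasPowerSum (d⁄dX ℂ φ) R (deriv g) :=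
  fun _ hx => (hφ.differentiableAt_and_hasSum_deriv hx).2

theorem unique (hR : 0 < R) (hφ : HasPowerSum φ R g) (hψ : HasPowerSum ψ R g) : φ = ψ := by
  have key : ∀ {χ : PowerSeries ℂ}, HasPowerSum χ R g →
      HasFPowerSeriesAt g (FormalMultilinearSeries.ofScalars ℂ fun k => coeff k χ) 0 := by
    intro χ hχ
    rw [hasFPowerSeriesAt_iff]
    filter_upwards [Metric.ball_mem_nhds (0 : ℂ) hR] with x hx
    simpa [mul_comm, FormalMultilinearSeries.coeff_ofScalars] using hχ x (by simpa using hx)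
  have := (key hφ).eq_formalMultilinearSeries (key hψ)
  rw [FormalMultilinearSeries.ofScalars_series_eq_iff] at this
  ext k
  exact congrFun this k

theorem of_differentiableOn (hg : DifferentiableOn ℂ g (Metric.ball 0 R)) :
    HasPowerSum (mk fun k => (k.factorial : ℂ)⁻¹ * iteratedDeriv k g 0) R g := fun x hx => by
  have := Complex.hasSum_taylorSeries_on_ball hg (z := x) (by simpa using hx)
  refine this.congr_fun fun k => ?_
  simp
  ring

end HasPowerSum

end

/-! ### Recursions with a parameter, and the equation in the uniformizing variable -/

section

/-- Weierstrass' theorem in σ on the unit disc about `σ₀`. The point is that the σ-derivative is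
again a power series in x on the same disc, hence holomorphic in x. -/
theorem HasPowerSum.hasDerivAt_param {u : ℕ → ℂ → ℂ} {b : ℕ → ℝ} {R : ℝ} {σ₀ : ℂ}
    (hu : ∀ k, Differentiable ℂ (u k)) (hub : ∀ k σ, ‖σ - σ₀‖ < 1 → ‖u k σ‖ ≤ b k)
    (hb : ∀ r, 0 ≤ r → r < R → Summable fun k => b k * r ^ k) :
    HasPowerSum (.mk fun k => deriv (u k) σ₀) R
      (fun x => deriv (fun σ => ∑' k, u k σ * x ^ k) σ₀) ∧
    ∀ x : ℂ, ‖x‖ < R → DifferentiableAt ℂ (fun σ => ∑' k, u k σ * x ^ k) σ₀ := by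
  have hU : IsOpen (Metric.ball σ₀ 1) := Metric.isOpen_ball
  have h0 : σ₀ ∈ Metric.ball σ₀ 1 := Metric.mem_ball_self one_pos
  have hd : ∀ (x : ℂ) k, DifferentiableOn ℂ (fun σ : ℂ => u k σ * x ^ k) (Metric.ball σ₀ 1) :=
    fun x k => ((hu k).mul_const _).differentiableOn
  have hle : ∀ (x : ℂ) (k : ℕ) (σ : ℂ), σ ∈ Metric.ball σ₀ 1 →
      ‖u k σ * x ^ k‖ ≤ b k * ‖x‖ ^ k := by
    intro x k σ hσ
    rw [norm_mul, norm_pow]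
    gcongr
    exact hub k σ (by simpa [dist_eq_norm] using hσ)
  constructor
  · intro x hx
    have := Complex.hasSum_deriv_of_summable_norm (hb _ (norm_nonneg x) hx) (hd x) hU (hle x) h0
    refine this.congr_fun fun k => ?_
    simp
  · intro x hx
    exact (Complex.differentiableOn_tsum_of_summable_norm (hb _ (norm_nonneg x) hx) (hd x) hU
      (hle x)).differentiableAt (hU.mem_nhds h0)

/-- The sequence with `f 0 = 1` and `f k = ∑ j < k, c k j * f j` for `k > 0`. -/
noncomputable def volterraSeq (c : ℕ → ℕ → ℂ) : ℕ → ℂ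
  | 0 => 1
  | k + 1 => ∑ j : Fin (k + 1), c (k + 1) j * volterraSeq c j

theorem volterraSeq_zero (c : ℕ → ℕ → ℂ) : volterraSeq c 0 = 1 := by
  rw [volterraSeq]

theorem volterraSeq_succ (c : ℕ → ℕ → ℂ) (k : ℕ) :
    volterraSeq c (k + 1) = ∑ j ∈ Finset.range (k + 1), c (k + 1) j * volterraSeq c j := by
  rw [volterraSeq, Finset.sum_range]

/-- A new term increases the partial sum of norms by a factor of at most 1 + M/(k + 1), and the
product of these factors is a binomial coefficient. Growth is thus polynomial in k, so the series
converges on the unit disc. -/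
theorem norm_volterraSeq_le {c : ℕ → ℕ → ℂ} {M : ℕ}
    (hc : ∀ k j, j ≤ k → ‖c (k + 1) j‖ ≤ M / (k + 1)) (k : ℕ) :
    ‖volterraSeq c k‖ ≤ (k + M).choose M := by
  have hT : ∀ k, ∑ j ∈ Finset.range (k + 1), ‖volterraSeq c j‖ ≤ (k + M).choose M := by
    intro k
    induction k with
    | zero => simp [volterraSeq_zero]
    | succ k ih =>
      rw [Finset.sum_range_succ]
      have h1 : ‖volterraSeq c (k + 1)‖ ≤
          M / (k + 1) * ∑ j ∈ Finset.range (k + 1), ‖volterraSeq c j‖ := by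
        rw [volterraSeq_succ, Finset.mul_sum]
        refine (norm_sum_le _ _).trans (Finset.sum_le_sum fun j hj => ?_)
        rw [norm_mul]
        gcongr
        exact hc k j (Nat.lt_succ_iff.1 (Finset.mem_range.1 hj))
      have h2 : (M / (k + 1) : ℝ) * ∑ j ∈ Finset.range (k + 1), ‖volterraSeq c j‖
          ≤ M / (k + 1) * (k + M).choose M := by gcongr
      have h3 : ((k + 1 + M).choose M : ℝ) = (k + M).choose M + M / (k + 1) * (k + M).choose M := by
        have := Nat.add_one_mul_choose_eq (k + M) k
        rw [show (k + M).choose k = (k + M).choose M from Nat.choose_symm_add,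
          show k + M + 1 = (k + 1) + M by ring,
          show (k + 1 + M).choose (k + 1) = (k + 1 + M).choose M from Nat.choose_symm_add] at this
        have h : ((k : ℝ) + 1 + M) * (k + M).choose M = (k + 1 + M).choose M * (k + 1) := by
          exact_mod_cast this
        field_simp
        linarith
      linarith
  exact (Finset.single_le_sum (fun j _ => norm_nonneg (volterraSeq c j))
    (Finset.self_mem_range_succ k)).trans (hT k)

theorem summable_choose_mul_pow (M : ℕ) {r : ℝ} (h0 : 0 ≤ r) (h1 : r < 1) :
    Summable fun k : ℕ => ((k + M).choose M : ℝ) * r ^ k :=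
  summable_choose_mul_geometric_of_norm_lt_one M (by rwa [Real.norm_of_nonneg h0])

theorem differentiable_volterraSeq {c : ℂ → ℕ → ℕ → ℂ}
    (hc : ∀ k j, Differentiable ℂ fun σ => c σ k j) (k : ℕ) :
    Differentiable ℂ fun σ => volterraSeq (c σ) k := by
  induction k using Nat.strong_induction_on with
  | _ k ih =>
    cases k with
    | zero => simp [volterraSeq_zero]
    | succ k =>
      simp only [volterraSeq_succ]
      exact Differentiable.fun_sum fun j hj =>
        (hc _ _).mul (ih j (Finset.mem_range.1 hj))

/-- The coefficients of `(2 m x ^ 2 - (6 m + 2) x) / (1 - x ^ 2)`. -/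
noncomputable def firstOrderCoeff (m i : ℕ) : ℂ :=
  if i = 0 then 0 else if Even i then 2 * m else -(6 * m + 2)

/-- The coefficients of `x / (1 + x) ^ 2`. -/
noncomputable def zerothOrderCoeff (i : ℕ) : ℂ := i * (-1) ^ (i + 1)

/-- The recursion kernel of the solution, in the variable `ρ` with `w = 4 ρ / (1 + ρ) ^ 2`, of the
hypergeometric equation with `a + b = 2 m + 1`, `a b = σ`, `c = m + 1`. -/
noncomputable def uniformizedKernel (m : ℕ) (σ : ℂ) (k j : ℕ) : ℂ :=
  (4 * σ * zerothOrderCoeff (k - j) - firstOrderCoeff m (k - j) * j) / (k * (k + m))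

/-- The double poles on the unit circle make the numerator grow only linearly in k, against a
quadratic denominator. -/
theorem norm_uniformizedKernel_le (m : ℕ) (σ : ℂ) (k j : ℕ) (hj : j ≤ k) :
    ‖uniformizedKernel m σ (k + 1) j‖ ≤ (6 * m + 2 + 4 * ‖σ‖) / (k + 1) := by
  have hp : ‖firstOrderCoeff m (k + 1 - j)‖ ≤ 6 * m + 2 := by
    unfold firstOrderCoeff
    split_ifs
    · simp; positivity
    · simp; linarith [(Nat.cast_nonneg m : (0 : ℝ) ≤ m)]
    · rw [norm_neg]
      exact_mod_cast (Complex.norm_natCast (6 * m + 2)).le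
  have hq : ‖zerothOrderCoeff (k + 1 - j)‖ ≤ k + 1 := by
    simp only [zerothOrderCoeff, norm_mul, Complex.norm_natCast, norm_pow, norm_neg, norm_one,
      one_pow, mul_one]
    exact_mod_cast Nat.sub_le (k + 1) j
  have hden : ‖(((k + 1 : ℕ) : ℂ) * (((k + 1 : ℕ) : ℂ) + m))‖ = (k + 1) * (k + 1 + m) := by
    exact_mod_cast Complex.norm_natCast ((k + 1) * (k + 1 + m))
  have hj' : (j : ℝ) ≤ k + 1 := by exact_mod_cast hj.trans (Nat.le_succ k)
  rw [uniformizedKernel, norm_div, hden, div_le_div_iff₀ (by positivity) (by positivity)]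
  have h1 : ‖4 * σ * zerothOrderCoeff (k + 1 - j) - firstOrderCoeff m (k + 1 - j) * j‖
      ≤ 4 * ‖σ‖ * (k + 1) + (6 * m + 2) * (k + 1) := by
    refine (norm_sub_le _ _).trans ?_
    rw [norm_mul, norm_mul, norm_mul, Complex.norm_natCast]
    norm_num
    gcongr
  have h2 : (0 : ℝ) ≤ (6 * m + 2 + 4 * ‖σ‖) * (k + 1) * m := by positivity
  have h3 : (0 : ℝ) ≤ k + 1 := by positivity
  nlinarith [mul_le_mul_of_nonneg_right h1 h3]

open PowerSeries

theorem PowerSeries.coeff_X_mul_derivative (φ : PowerSeries ℂ) (k : ℕ) :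
    coeff k (X * d⁄dX ℂ φ) = k * coeff k φ := by
  cases k with
  | zero => simp
  | succ k => simp [coeff_succ_X_mul, coeff_derivative, mul_comm]

theorem mk_firstOrderCoeff (m : ℕ) :
    (1 - X ^ 2) * mk (firstOrderCoeff m) = C (2 * (m : ℂ)) * X ^ 2 - C (6 * (m : ℂ) + 2) * X := by
  ext k
  rw [sub_mul, one_mul, map_sub, map_sub, coeff_C_mul, coeff_C_mul, coeff_mk]
  match k with
  | 0 => simp [firstOrderCoeff]
  | 1 => simp [firstOrderCoeff, coeff_X_pow_mul', coeff_X_pow]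
  | k + 2 =>
    rw [coeff_X_pow_mul', coeff_X_pow, coeff_X]
    rcases k with _ | k
    · simp [firstOrderCoeff]
    · have : Even (k + 1 + 2) ↔ Even (k + 1) := by simp [parity_simps]
      simp [firstOrderCoeff, this]

theorem mk_zerothOrderCoeff : (1 + X) ^ 2 * mk zerothOrderCoeff = (X : PowerSeries ℂ) := by
  have : (1 + X) ^ 2 * mk zerothOrderCoeff = mk zerothOrderCoeff + C 2 * (X * mk zerothOrderCoeff)
      + X ^ 2 * mk zerothOrderCoeff := by
    rw [show (C 2 : PowerSeries ℂ) = 2 from map_ofNat C 2]; ring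
  rw [this]
  ext k
  rw [map_add, map_add, coeff_C_mul, coeff_mk]
  match k with
  | 0 => simp [zerothOrderCoeff]
  | 1 => simp [zerothOrderCoeff, coeff_X_pow_mul', coeff_succ_X_mul, -coeff_zero_eq_constantCoeff]
  | k + 2 =>
    rw [coeff_X_pow_mul', coeff_succ_X_mul, coeff_X]
    simp [zerothOrderCoeff, pow_succ]
    ring

/-- The solution in the variable `ρ`, as a formal power series. -/
noncomputable def uniformizedSeries (m : ℕ) (σ : ℂ) : PowerSeries ℂ :=
  mk (volterraSeq (uniformizedKernel m σ))

/-- The coefficient of X^k is the defining recursion multiplied by k(k + m). The diagonal term j = k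
drops out since both coefficient sequences vanish at 0. -/
theorem uniformizedSeries_ode (m : ℕ) (σ : ℂ) :
    X * d⁄dX ℂ (X * d⁄dX ℂ (uniformizedSeries m σ))
      + C (m : ℂ) * (X * d⁄dX ℂ (uniformizedSeries m σ))
    = C (4 * σ) * (uniformizedSeries m σ * mk zerothOrderCoeff)
      - X * d⁄dX ℂ (uniformizedSeries m σ) * mk (firstOrderCoeff m) := by
  ext k
  rw [map_add, map_sub, coeff_C_mul, coeff_C_mul, coeff_X_mul_derivative, coeff_X_mul_derivative,
    coeff_mul, coeff_mul, Finset.Nat.sum_antidiagonal_eq_sum_range_succ_mk,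
    Finset.Nat.sum_antidiagonal_eq_sum_range_succ_mk, Finset.sum_range_succ, Finset.sum_range_succ]
  simp only [coeff_X_mul_derivative, coeff_mk, uniformizedSeries]
  simp only [Nat.sub_self, firstOrderCoeff, zerothOrderCoeff, if_true, Nat.cast_zero, zero_mul,
    mul_zero, add_zero]
  cases k with
  | zero => simp
  | succ k =>
    have hk : ((k + 1 : ℕ) : ℂ) * ((k + 1 : ℕ) + m) ≠ 0 := by
      exact_mod_cast (by positivity : (k + 1) * (k + 1 + m) ≠ 0)
    rw [volterraSeq_succ]
    simp only [Finset.mul_sum]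
    rw [← Finset.sum_sub_distrib, ← Finset.sum_add_distrib]
    refine Finset.sum_congr rfl fun j _ => ?_
    have h : uniformizedKernel m σ (k + 1) j * (((k + 1 : ℕ) : ℂ) * ((k + 1 : ℕ) + m)) = _ :=
      div_mul_cancel₀ _ hk
    simp only [firstOrderCoeff, zerothOrderCoeff] at h
    linear_combination volterraSeq (uniformizedKernel m σ) j * h

end

/-! ### Continuation to the cut plane by uniformization -/

section

open PowerSeries

/-- The sum on the unit disc of `uniformizedSeries`. -/
noncomputable def uniformizedFun (m : ℕ) (σ x : ℂ) : ℂ :=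
  ∑' k, volterraSeq (uniformizedKernel m σ) k * x ^ k

theorem exists_norm_volterraSeq_uniformizedKernel_le (m : ℕ) (σ₀ : ℂ) : ∃ M : ℕ, ∀ k σ,
    ‖σ - σ₀‖ < 1 → ‖volterraSeq (uniformizedKernel m σ) k‖ ≤ (k + M).choose M := by
  obtain ⟨M, hM⟩ := exists_nat_ge (6 * m + 2 + 4 * (‖σ₀‖ + 1) : ℝ)
  refine ⟨M, fun k σ hσ => norm_volterraSeq_le (fun k j hj => ?_) k⟩
  refine (norm_uniformizedKernel_le m σ k j hj).trans ?_
  have : ‖σ‖ ≤ ‖σ₀‖ + 1 := by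
    have := norm_sub_norm_le σ σ₀
    linarith
  gcongr
  linarith

theorem hasPowerSum_uniformizedFun (m : ℕ) (σ : ℂ) :
    HasPowerSum (uniformizedSeries m σ) 1 (uniformizedFun m σ) := by
  intro x hx
  obtain ⟨M, hM⟩ := exists_norm_volterraSeq_uniformizedKernel_le m σ
  simp only [uniformizedSeries, coeff_mk]
  refine Summable.hasSum (Summable.of_norm_bounded
    (summable_choose_mul_pow M (norm_nonneg x) hx) fun k => ?_)
  rw [norm_mul, norm_pow]
  gcongr
  exact hM k σ (by simp)

theorem hasPowerSum_X_mul_derivative {φ : PowerSeries ℂ} {R : ℝ} {g : ℂ → ℂ}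
    (h : HasPowerSum φ R g) : HasPowerSum (X * d⁄dX ℂ φ) R (fun x => x * deriv g x) :=
  h.derivative.X_mul

/-- The factor (1 - x^2)(1 + x)^2 clears the denominators, so that only polynomial multiples of
convergent series have to be compared. -/
theorem uniformizedFun_ode (m : ℕ) (σ : ℂ) {x : ℂ} (hx : ‖x‖ < 1) :
    (1 - x ^ 2) * (1 + x) ^ 2 * (x * deriv (fun y => y * deriv (uniformizedFun m σ) y) x
        + m * (x * deriv (uniformizedFun m σ) x))
      = (1 - x ^ 2) * (4 * σ * x) * uniformizedFun m σ x
        - (1 + x) ^ 2 * (2 * m * x ^ 2 - (6 * m + 2) * x) * (x * deriv (uniformizedFun m σ) x) := by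
  have h0 := hasPowerSum_uniformizedFun m σ
  have h1 := hasPowerSum_X_mul_derivative h0
  have h2 := hasPowerSum_X_mul_derivative h1
  have hl := (h2.add (h1.C_mul m)).poly_mul ((1 - .X ^ 2) * (1 + .X) ^ 2)
  have hr := (h0.poly_mul ((1 - .X ^ 2) * (.C (4 * σ) * .X))).add
    (h1.poly_mul (-((1 + .X) ^ 2 * (.C (2 * (m : ℂ)) * .X ^ 2 - .C (6 * (m : ℂ) + 2) * .X))))
  have e := uniformizedSeries_ode m σ
  have e1 := mk_firstOrderCoeff m
  have e2 := mk_zerothOrderCoeff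
  have key := hl x hx
  have key' := hr x hx
  rw [show (((1 - .X ^ 2) * (1 + .X) ^ 2 : Polynomial ℂ) : PowerSeries ℂ) *
      (X * d⁄dX ℂ (X * d⁄dX ℂ (uniformizedSeries m σ))
      + C (m : ℂ) * (X * d⁄dX ℂ (uniformizedSeries m σ))) =
      (((1 - .X ^ 2) * (.C (4 * σ) * .X) : Polynomial ℂ) : PowerSeries ℂ) * uniformizedSeries m σ
      + ((-((1 + .X) ^ 2 * (.C (2 * (m : ℂ)) * .X ^ 2 - .C (6 * (m : ℂ) + 2) * .X)) :
        Polynomial ℂ) : PowerSeries ℂ) * (X * d⁄dX ℂ (uniformizedSeries m σ)) from ?_] at key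
  · have := key.unique key'
    simp only [Polynomial.eval_mul, Polynomial.eval_sub, Polynomial.eval_one, Polynomial.eval_pow,
      Polynomial.eval_X, Polynomial.eval_add, Polynomial.eval_C, Polynomial.eval_neg] at this
    linear_combination this
  · rw [e]
    simp only [Polynomial.coe_mul, Polynomial.coe_sub, Polynomial.coe_one, Polynomial.coe_pow,
      Polynomial.coe_X, Polynomial.coe_add, Polynomial.coe_C, Polynomial.coe_neg]
    linear_combination (1 - X ^ 2) * C (4 * σ) * uniformizedSeries m σ * e2
      - (1 + X) ^ 2 * (X * d⁄dX ℂ (uniformizedSeries m σ)) * e1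

/-- The cut plane `ℂ \ [1, ∞)`. -/
def cutPlane : Set ℂ := {w : ℂ | 1 - w ∈ Complex.slitPlane}

theorem isOpen_cutPlane : IsOpen cutPlane :=
  Complex.isOpen_slitPlane.preimage (continuous_const.sub continuous_id)

theorem ball_subset_cutPlane : Metric.ball (0 : ℂ) 1 ⊆ cutPlane := by
  intro w hw
  have hw' : ‖w‖ < 1 := by simpa using hw
  refine Or.inl ?_
  have := (Complex.abs_re_le_norm w)
  simp only [Complex.sub_re, Complex.one_re]
  linarith [le_abs_self w.re]

/-- The principal square root of `1 - w`. -/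
noncomputable def sqrtOneSub (w : ℂ) : ℂ := (1 - w) ^ (1 / 2 : ℂ)

theorem sqrtOneSub_sq (w : ℂ) : sqrtOneSub w ^ 2 = 1 - w := by
  rw [sqrtOneSub, ← Complex.cpow_nat_mul]
  simp

theorem sqrtOneSub_re_pos {w : ℂ} (hw : w ∈ cutPlane) : 0 < (sqrtOneSub w).re := by
  have h0 : 1 - w ≠ 0 := Complex.slitPlane_ne_zero hw
  have h := Complex.mem_slitPlane_iff_arg.1 hw
  rw [sqrtOneSub, Complex.cpow_def_of_ne_zero h0, Complex.exp_re]
  refine mul_pos (Real.exp_pos _) (Real.cos_pos_of_mem_Ioo ?_)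
  have : (Complex.log (1 - w) * (1 / 2)).im = Complex.arg (1 - w) / 2 := by
    rw [Complex.mul_im, Complex.log_im]
    norm_num
    ring
  rw [this]
  have h1 := Complex.neg_pi_lt_arg (1 - w)
  have h2 := lt_of_le_of_ne (Complex.arg_le_pi (1 - w)) h.1
  constructor <;> linarith

theorem hasDerivAt_sqrtOneSub {w : ℂ} (hw : w ∈ cutPlane) :
    HasDerivAt sqrtOneSub (-1 / (2 * sqrtOneSub w)) w := by
  have h0 : 1 - w ≠ 0 := Complex.slitPlane_ne_zero hw
  have h1 : sqrtOneSub w ≠ 0 := fun h => by simpa [h] using sqrtOneSub_re_pos hw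
  have := (((hasDerivAt_id w).const_sub 1).cpow_const (c := (1 / 2 : ℂ)) hw)
  refine this.congr_deriv ?_
  rw [id, Complex.cpow_sub _ _ h0]
  change 1 / 2 * (sqrtOneSub w / (1 - w) ^ (1 : ℂ)) * -1 = _
  rw [Complex.cpow_one, ← sqrtOneSub_sq]
  field_simp

/-- The conformal map of `ℂ \ [1, ∞)` onto the unit disc, with `w = 4 ρ / (1 + ρ) ^ 2`. -/
noncomputable def uniformizer (w : ℂ) : ℂ := (1 - sqrtOneSub w) / (1 + sqrtOneSub w)

theorem one_add_sqrtOneSub_ne_zero {w : ℂ} (hw : w ∈ cutPlane) : 1 + sqrtOneSub w ≠ 0 := by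
  intro h
  have := congrArg Complex.re h
  have h2 := sqrtOneSub_re_pos hw
  simp at this
  linarith

theorem sqrtOneSub_ne_zero {w : ℂ} (hw : w ∈ cutPlane) : sqrtOneSub w ≠ 0 :=
  fun h => by simpa [h] using sqrtOneSub_re_pos hw

/-- A point of the right half-plane is closer to 1 than to -1. -/
theorem norm_uniformizer_lt_one {w : ℂ} (hw : w ∈ cutPlane) : ‖uniformizer w‖ < 1 := by
  rw [uniformizer, norm_div, div_lt_one (norm_pos_iff.2 (one_add_sqrtOneSub_ne_zero hw)),
    ← sq_lt_sq₀ (norm_nonneg _) (norm_nonneg _), Complex.sq_norm, Complex.sq_norm,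
    Complex.normSq_apply, Complex.normSq_apply]
  have := sqrtOneSub_re_pos hw
  simp
  nlinarith

theorem hasDerivAt_uniformizer {w : ℂ} (hw : w ∈ cutPlane) :
    HasDerivAt uniformizer (1 / (sqrtOneSub w * (1 + sqrtOneSub w) ^ 2)) w := by
  have h1 := one_add_sqrtOneSub_ne_zero hw
  have h2 := sqrtOneSub_ne_zero hw
  have h := hasDerivAt_sqrtOneSub hw
  refine ((h.const_sub 1).div (h.const_add 1) h1).congr_deriv ?_
  field_simp
  ring

theorem uniformizer_zero : uniformizer 0 = 0 := by
  simp [uniformizer, sqrtOneSub]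

/-- The continuation to `ℂ \ [1, ∞)` of the series `₂F₁(a, b; m + 1; w)`, where `a + b = 2 m + 1`
and `a b = σ`. -/
noncomputable def gaussCut (m : ℕ) (σ w : ℂ) : ℂ := uniformizedFun m σ (uniformizer w)

theorem differentiableOn_gaussCut (m : ℕ) (σ : ℂ) : DifferentiableOn ℂ (gaussCut m σ) cutPlane :=
  fun _ hw => (DifferentiableAt.comp _
    ((hasPowerSum_uniformizedFun m σ).differentiableAt_and_hasSum_deriv
      (norm_uniformizer_lt_one hw)).1
    (hasDerivAt_uniformizer hw).differentiableAt).differentiableWithinAt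

/-- With q = √(1 - w), so w = 1 - q^2 and ρ = (1 - q)/(1 + q), the Euler operators are related by w
d/dw = q⁻¹ ρ d/dρ. -/
theorem mul_deriv_comp_uniformizer {g : ℂ → ℂ} {w : ℂ} (hw : w ∈ cutPlane)
    (hg : DifferentiableAt ℂ g (uniformizer w)) :
    w * deriv (fun y => g (uniformizer y)) w
      = uniformizer w * deriv g (uniformizer w) / sqrtOneSub w := by
  have h1 := one_add_sqrtOneSub_ne_zero hw
  have h2 := sqrtOneSub_ne_zero hw
  have h : HasDerivAt (fun y => g (uniformizer y)) _ w :=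
    hg.hasDerivAt.comp w (hasDerivAt_uniformizer hw)
  rw [h.deriv, uniformizer]
  have h3 : w = 1 - sqrtOneSub w ^ 2 := by rw [sqrtOneSub_sq]; ring
  field_simp
  linear_combination (deriv g ((1 - sqrtOneSub w) / (1 + sqrtOneSub w))) * h3

/-- This is the hypergeometric equation in terms of θ = w d/dw. It is the equation in ρ transported
by θ = q⁻¹ ρ d/dρ; the second application of θ also differentiates q⁻¹, with θ(q⁻¹) = w/(2q^3). -/
theorem gaussCut_ode (m : ℕ) (σ : ℂ) {w : ℂ} (hw : w ∈ cutPlane) :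
    w * deriv (fun y => y * deriv (gaussCut m σ) y) w + m * (w * deriv (gaussCut m σ) w)
      = w * (w * deriv (fun y => y * deriv (gaussCut m σ) y) w
        + (2 * m + 1) * (w * deriv (gaussCut m σ) w) + σ * gaussCut m σ w) := by
  have hps := hasPowerSum_uniformizedFun m σ
  have hx := norm_uniformizer_lt_one hw
  have h1 := one_add_sqrtOneSub_ne_zero hw
  have h2 := sqrtOneSub_ne_zero hw
  have hθ : ∀ y ∈ cutPlane, y * deriv (gaussCut m σ) y =
      (fun x => x * deriv (uniformizedFun m σ) x) (uniformizer y) / sqrtOneSub y := fun y hy =>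
    mul_deriv_comp_uniformizer hy
      (hps.differentiableAt_and_hasSum_deriv (norm_uniformizer_lt_one hy)).1
  have hd1 := ((hasPowerSum_X_mul_derivative hps).differentiableAt_and_hasSum_deriv hx).1
  have hev : (fun y => y * deriv (gaussCut m σ) y) =ᶠ[𝓝 w]
      fun y => (fun x => x * deriv (uniformizedFun m σ) x) (uniformizer y) / sqrtOneSub y := by
    filter_upwards [isOpen_cutPlane.mem_nhds hw] with y hy using hθ y hy
  have hcomp : DifferentiableAt ℂ
      (fun y => (fun x => x * deriv (uniformizedFun m σ) x) (uniformizer y)) w :=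
    DifferentiableAt.comp w hd1 (hasDerivAt_uniformizer hw).differentiableAt
  have hθθ : w * deriv (fun y => y * deriv (gaussCut m σ) y) w =
      (uniformizer w * deriv (fun x => x * deriv (uniformizedFun m σ) x) (uniformizer w))
        / sqrtOneSub w ^ 2
      + w / (2 * sqrtOneSub w ^ 3) * (uniformizer w * deriv (uniformizedFun m σ) (uniformizer w)) := by
    have hdiv : HasDerivAt (fun y => (fun x => x * deriv (uniformizedFun m σ) x) (uniformizer y)
      / sqrtOneSub y) _ w := hcomp.hasDerivAt.div (hasDerivAt_sqrtOneSub hw) h2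
    rw [hev.deriv_eq, hdiv.deriv]
    have := mul_deriv_comp_uniformizer hw hd1
    field_simp
    field_simp at this
    linear_combination 2 * sqrtOneSub w * this
  have hode := uniformizedFun_ode m σ hx
  rw [hθθ, hθ w hw]
  simp only [gaussCut]
  have h3 : w = 1 - sqrtOneSub w ^ 2 := by rw [sqrtOneSub_sq]; ring
  have hρ : uniformizer w = (1 - sqrtOneSub w) / (1 + sqrtOneSub w) := rfl
  generalize uniformizer w * deriv (fun x => x * deriv (uniformizedFun m σ) x) (uniformizer w)
    = g2 at *
  generalize uniformizer w * deriv (uniformizedFun m σ) (uniformizer w) = g1 at *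
  generalize uniformizedFun m σ (uniformizer w) = g0 at *
  generalize uniformizer w = ρ at *
  generalize sqrtOneSub w = q at *
  clear hθθ hθ hev hcomp hd1 hps
  subst hρ
  -- The equation in ρ, rewritten rationally in q by ρ = (1 - q)/(1 + q).
  have key : q * (g2 + m * g1) = q * σ * (1 - q ^ 2) * g0
      - (2 * m * (1 - q) ^ 2 - (6 * m + 2) * (1 - q ^ 2)) / 4 * g1 := by
    field_simp at hode
    field_simp
    ring_nf at hode ⊢
    linear_combination (1 / 4) * hode
  rw [h3]
  field_simp
  linear_combination 2 * q ^ 2 * key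

end

/-! ### Gauss coefficients and the derivative in the parameter σ -/

section

open PowerSeries

/-- The coefficients of the series `₂F₁(a, b; m + 1; w)`, where `a + b = 2 m + 1`, `a b = σ`. -/
noncomputable def gaussCoeff (m : ℕ) (σ : ℂ) : ℕ → ℂ
  | 0 => 1
  | k + 1 => (k * (k + (2 * m + 1)) + σ) / ((k + 1) * (k + 1 + m)) * gaussCoeff m σ k

theorem gaussCoeff_zero (m : ℕ) (σ : ℂ) : gaussCoeff m σ 0 = 1 := rfl

theorem gaussCoeff_succ (m : ℕ) (σ : ℂ) (k : ℕ) :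
    ((k : ℂ) + 1) * (k + 1 + m) * gaussCoeff m σ (k + 1)
      = (k * (k + (2 * m + 1)) + σ) * gaussCoeff m σ k := by
  have h : ((k : ℂ) + 1) * (k + 1 + m) ≠ 0 := by
    exact_mod_cast (by positivity : (k + 1) * (k + 1 + m) ≠ 0)
  rw [gaussCoeff, ← mul_assoc, mul_div_cancel₀ _ h]

/-- The function is holomorphic on the unit disc, so its Taylor series converges there. The
differential equation forces the Gauss recursion on the coefficients, and the value at 0 is 1. -/
theorem hasPowerSum_gaussCut (m : ℕ) (σ : ℂ) :
    HasPowerSum (mk (gaussCoeff m σ)) 1 (gaussCut m σ) := by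
  have h0 := HasPowerSum.of_differentiableOn
    ((differentiableOn_gaussCut m σ).mono ball_subset_cutPlane)
  set φ : PowerSeries ℂ := mk fun k => (k.factorial : ℂ)⁻¹ * iteratedDeriv k (gaussCut m σ) 0
    with hφ
  have h1 := hasPowerSum_X_mul_derivative h0
  have h2 := hasPowerSum_X_mul_derivative h1
  have hl := h2.add (h1.C_mul m)
  have hr := ((h2.add (h1.C_mul (2 * m + 1))).add (h0.C_mul σ)).X_mul
  have heq := hl.unique one_pos (hr.congr fun w hw =>
    (gaussCut_ode m σ (ball_subset_cutPlane (by simpa using hw))).symm)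
  have hc : ∀ k, coeff k φ = gaussCoeff m σ k := by
    intro k
    induction k with
    | zero =>
      have h3 := (hasPowerSum_uniformizedFun m σ) 0 (by simp)
      have h4 := h3.unique (hasSum_single 0 fun k hk => by simp [hk])
      simp [hφ, gaussCut, uniformizer_zero, gaussCoeff_zero, h4, uniformizedSeries,
        volterraSeq_zero, -coeff_zero_eq_constantCoeff]
    | succ k ih =>
      have h := congrArg (coeff (k + 1)) heq
      simp only [map_add (coeff (k + 1)), coeff_C_mul, coeff_X_mul_derivative] at h
      rw [coeff_succ_X_mul] at h
      simp only [map_add (coeff k), coeff_C_mul, coeff_X_mul_derivative] at h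
      have hne : ((k : ℂ) + 1) * (k + 1 + m) ≠ 0 := by
        exact_mod_cast (by positivity : (k + 1) * (k + 1 + m) ≠ 0)
      apply mul_left_cancel₀ hne
      rw [gaussCoeff_succ, ← ih]
      push_cast at h
      linear_combination h
  have : mk (gaussCoeff m σ) = φ := by
    ext k
    rw [coeff_mk, hc]
  rw [this]
  exact h0

theorem differentiable_gaussCoeff (m k : ℕ) : Differentiable ℂ fun σ => gaussCoeff m σ k := by
  induction k with
  | zero => simp [gaussCoeff_zero]
  | succ k ih =>
    simp only [gaussCoeff]
    exact (((differentiable_id.const_add _).div_const _).mul ih)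

/-- A crude geometric bound, locally uniform in σ. It is enough for differentiating the series in σ
on some disc about w = 0. -/
theorem norm_gaussCoeff_le (m : ℕ) (σ : ℂ) (k : ℕ) :
    ‖gaussCoeff m σ k‖ ≤ (2 * m + 1 + ‖σ‖) ^ k := by
  induction k with
  | zero => simp [gaussCoeff_zero]
  | succ k ih =>
    have hden : ‖((k : ℂ) + 1) * (k + 1 + m)‖ = (k + 1) * (k + 1 + m) := by
      exact_mod_cast Complex.norm_natCast ((k + 1) * (k + 1 + m))
    have h1 : ‖(k : ℂ) * (k + (2 * m + 1)) + σ‖ ≤ k * (k + (2 * m + 1)) + ‖σ‖ := by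
      refine (norm_add_le _ _).trans (add_le_add_left (le_of_eq ?_) _)
      exact_mod_cast Complex.norm_natCast (k * (k + (2 * m + 1)))
    rw [gaussCoeff, norm_mul, norm_div, hden, pow_succ']
    have h2 : ‖(k : ℂ) * (k + (2 * m + 1)) + σ‖ / ((k + 1) * (k + 1 + m)) ≤ 2 * m + 1 + ‖σ‖ := by
      rw [div_le_iff₀ (by positivity)]
      refine h1.trans ?_
      have hk : (0 : ℝ) ≤ k := Nat.cast_nonneg k
      have hm : (0 : ℝ) ≤ m := Nat.cast_nonneg m
      have hs := norm_nonneg σ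
      have : (0 : ℝ) ≤ ‖σ‖ * ((k + 1) * (k + 1 + m) - 1) := by
        refine mul_nonneg hs ?_
        nlinarith [mul_nonneg hk hk, mul_nonneg hk hm]
      have h5 : (k : ℝ) * (k + (2 * m + 1)) ≤ (2 * m + 1) * ((k + 1) * (k + 1 + m)) := by
        have := mul_nonneg hk hm
        have := mul_nonneg hm hm
        have := mul_nonneg hk (mul_nonneg hm hm)
        have := mul_nonneg (mul_nonneg hk hk) hm
        nlinarith
      linarith
    gcongr

/-- The derivative of `gaussCut` with respect to the parameter `σ`. -/
noncomputable def gaussCutDeriv (m : ℕ) (σ w : ℂ) : ℂ := deriv (fun s => gaussCut m s w) σ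

theorem differentiable_uniformizedKernel (m k j : ℕ) :
    Differentiable ℂ fun σ => uniformizedKernel m σ k j := by
  simp only [uniformizedKernel]
  fun_prop

theorem hasPowerSum_uniformizedFun_param (m : ℕ) (σ : ℂ) :
    HasPowerSum (.mk fun k => deriv (fun s => volterraSeq (uniformizedKernel m s) k) σ) 1
      (fun x => deriv (fun s => uniformizedFun m s x) σ) ∧
    ∀ x : ℂ, ‖x‖ < 1 → DifferentiableAt ℂ (fun s => uniformizedFun m s x) σ := by
  obtain ⟨M, hM⟩ := exists_norm_volterraSeq_uniformizedKernel_le m σ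
  exact HasPowerSum.hasDerivAt_param
    (u := fun k s => volterraSeq (uniformizedKernel m s) k)
    (fun k => differentiable_volterraSeq (fun k j => differentiable_uniformizedKernel m k j) k)
    hM fun r h0 h1 => summable_choose_mul_pow M h0 h1

theorem hasDerivAt_gaussCut_param (m : ℕ) (σ : ℂ) {w : ℂ} (hw : w ∈ cutPlane) :
    HasDerivAt (fun s => gaussCut m s w) (gaussCutDeriv m σ w) σ :=
  ((hasPowerSum_uniformizedFun_param m σ).2 _ (norm_uniformizer_lt_one hw)).hasDerivAt

theorem differentiableOn_gaussCutDeriv (m : ℕ) (σ : ℂ) :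
    DifferentiableOn ℂ (gaussCutDeriv m σ) cutPlane :=
  fun _ hw => (DifferentiableAt.comp _
    ((hasPowerSum_uniformizedFun_param m σ).1.differentiableAt_and_hasSum_deriv
      (norm_uniformizer_lt_one hw)).1
    (hasDerivAt_uniformizer hw).differentiableAt).differentiableWithinAt

/-- Small w suffices: holomorphy on the cut plane is already known, and the identity theorem later
extends what is found near 0. -/
theorem exists_hasPowerSum_gaussCutDeriv (m : ℕ) (σ : ℂ) : ∃ R : ℝ, 0 < R ∧
    HasPowerSum (mk fun k => deriv (fun s => gaussCoeff m s k) σ) R (gaussCutDeriv m σ) := by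
  set B : ℝ := 2 * m + 1 + (‖σ‖ + 1) with hB
  have hB1 : 1 ≤ B := by
    have : (0 : ℝ) ≤ 2 * m := by positivity
    linarith [norm_nonneg σ]
  have hB0 : 0 < B := by linarith
  refine ⟨B⁻¹, inv_pos.2 hB0, ?_⟩
  have h := (HasPowerSum.hasDerivAt_param (u := fun k s => gaussCoeff m s k)
    (b := fun k => B ^ k) (R := B⁻¹) (σ₀ := σ)
    (differentiable_gaussCoeff m) (fun k s hs => (norm_gaussCoeff_le m s k).trans ?_)
    (fun r h0 hr => ?_)).1
  · refine h.congr fun x hx => ?_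
    -- For fixed x the series equals `gaussCut` for every value of the parameter, so the two
    -- functions of s, and hence their derivatives, coincide.
    refine congrArg (fun f => deriv f σ) (funext fun s => ?_)
    have hx1 : ‖x‖ < 1 := hx.trans_le (inv_le_one_of_one_le₀ hB1)
    simpa using (hasPowerSum_gaussCut m s x hx1).tsum_eq
  · have : ‖s‖ ≤ ‖σ‖ + 1 := by
      have := norm_sub_norm_le s σ
      linarith
    rw [hB]
    gcongr
  · simp only [← mul_pow]
    refine summable_geometric_of_lt_one (by positivity) ?_
    calc B * r < B * B⁻¹ := by gcongr
      _ = 1 := mul_inv_cancel₀ hB0.ne'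

theorem deriv_gaussCoeff_zero (m : ℕ) (σ : ℂ) : deriv (fun s => gaussCoeff m s 0) σ = 0 := by
  simp [gaussCoeff_zero]

theorem deriv_gaussCoeff_succ (m : ℕ) (σ : ℂ) (k : ℕ) :
    ((k : ℂ) + 1) * (k + 1 + m) * deriv (fun s => gaussCoeff m s (k + 1)) σ
      = (k * (k + (2 * m + 1)) + σ) * deriv (fun s => gaussCoeff m s k) σ + gaussCoeff m σ k := by
  have h1 := ((differentiable_gaussCoeff m (k + 1)) σ).hasDerivAt.const_mul
    (((k : ℂ) + 1) * (k + 1 + m))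
  have h2 := ((hasDerivAt_id σ).const_add ((k : ℂ) * (k + (2 * m + 1)))).mul
    ((differentiable_gaussCoeff m k) σ).hasDerivAt
  simp only [gaussCoeff_succ] at h1
  have := h1.unique h2
  simp only [id] at this
  rw [this]
  ring

end

/-! ### The hypergeometric operator on formal power series and its terminating solutions -/

section

open PowerSeries

/-- The hypergeometric operator `x (1 - x) φ'' + (c - d x) φ' + q φ` on formal power series. -/
noncomputable def hgOp (c d q : ℂ) (φ : PowerSeries ℂ) : PowerSeries ℂ :=
  X * (1 - X) * d⁄dX ℂ (d⁄dX ℂ φ) + (C c - C d * X) * d⁄dX ℂ φ + C q * φ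

theorem coeff_hgOp (c d q : ℂ) (φ : PowerSeries ℂ) (k : ℕ) :
    coeff k (hgOp c d q φ) =
      (k + 1) * (k + c) * coeff (k + 1) φ - (k * (k - 1) + d * k - q) * coeff k φ := by
  have e : hgOp c d q φ = X * d⁄dX ℂ (d⁄dX ℂ φ) - (X * d⁄dX ℂ (X * d⁄dX ℂ φ) - X * d⁄dX ℂ φ)
      + C c * d⁄dX ℂ φ - C d * (X * d⁄dX ℂ φ) + C q * φ := by
    simp only [hgOp, Derivation.leibniz, derivative_X, smul_eq_mul]
    ring
  rw [e]
  simp only [map_add (coeff k), map_sub (coeff k), coeff_C_mul, coeff_X_mul_derivative]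
  simp only [coeff_derivative]
  ring

theorem hgOp_add (c d q : ℂ) (φ ψ : PowerSeries ℂ) :
    hgOp c d q (φ + ψ) = hgOp c d q φ + hgOp c d q ψ := by
  simp only [hgOp, map_add]
  ring

theorem hgOp_C_mul (c d q a : ℂ) (φ : PowerSeries ℂ) :
    hgOp c d q (C a * φ) = C a * hgOp c d q φ := by
  simp only [hgOp, Derivation.leibniz, derivative_C, smul_eq_mul, map_add, map_zero, mul_zero]
  ring

theorem hgOp_sub (c d q : ℂ) (φ ψ : PowerSeries ℂ) :
    hgOp c d q (φ - ψ) = hgOp c d q φ - hgOp c d q ψ := by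
  simp only [hgOp, map_sub]
  ring

theorem one_sub_X_ne_zero : (1 - X : PowerSeries ℂ) ≠ 0 := by
  intro h
  simpa using congrArg constantCoeff h

/-- Euler's transformation of the hypergeometric operator. -/
theorem hgOp_one_sub_X_pow_mul (m : ℕ) (q : ℂ) (φ : PowerSeries ℂ) :
    hgOp (m + 1) 2 (q + m * (m + 1)) ((1 - X) ^ m * φ)
      = (1 - X) ^ m * hgOp (m + 1) (2 * m + 2) q φ := by
  apply mul_left_cancel₀ one_sub_X_ne_zero
  have h1 : (1 - X) * d⁄dX ℂ ((1 - X : PowerSeries ℂ) ^ m) = -(m : PowerSeries ℂ) * (1 - X) ^ m := by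
    rw [derivative_pow]
    cases m with
    | zero => simp
    | succ m => simp [pow_succ]; ring
  have h2 : (1 - X) * d⁄dX ℂ (d⁄dX ℂ ((1 - X : PowerSeries ℂ) ^ m))
      = (1 - (m : PowerSeries ℂ)) * d⁄dX ℂ ((1 - X) ^ m) := by
    have := congrArg (d⁄dX ℂ) h1
    simp only [Derivation.leibniz, smul_eq_mul, map_sub, derivative_X, map_neg,
      Derivation.map_natCast, Derivation.map_one_eq_zero] at this
    linear_combination this
  simp only [hgOp, Derivation.leibniz, smul_eq_mul, map_add, map_mul, map_natCast, map_one,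
    map_ofNat]
  generalize d⁄dX ℂ (d⁄dX ℂ ((1 - X : PowerSeries ℂ) ^ m)) = e2 at *
  generalize d⁄dX ℂ ((1 - X : PowerSeries ℂ) ^ m) = e1 at *
  generalize (1 - X : PowerSeries ℂ) ^ m = e at *
  linear_combination (X * (1 - X) * φ) * h2 + (2 * X * (1 - X) * d⁄dX ℂ φ
    + (m + 1 - 2 * X) * φ + X * (1 - m) * φ) * h1

/-- The exponents at 0 are 0 and -m. Since (k + 1)(k + m + 1) never vanishes, the recursion
determines every coefficient from the constant one. -/
theorem eq_zero_of_hgOp_eq_zero {m : ℕ} {d q : ℂ} {φ : PowerSeries ℂ}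
    (h : hgOp (m + 1) d q φ = 0) (h0 : coeff 0 φ = 0) : φ = 0 := by
  ext k
  induction k with
  | zero => simpa using h0
  | succ k ih =>
    have := congrArg (coeff k) h
    rw [coeff_hgOp, ih] at this
    have hne : ((k : ℂ) + 1) * (k + (m + 1)) ≠ 0 := by
      exact_mod_cast (by positivity : (k + 1) * (k + (m + 1)) ≠ 0)
    simpa [hne] using this

/-- The recursion can be run downwards from k = n, because k(k + 1) - n(n + 1) = (k - n)(k + n + 1)
is nonzero for k < n. This compares solutions written in powers of 1 - X, whose coefficient of X^n
is easy to read off. -/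
theorem eq_zero_of_hgOp_eq_zero_of_coeff {m n : ℕ} {φ : PowerSeries ℂ}
    (h : hgOp (m + 1) 2 (n * (n + 1)) φ = 0) (hn : coeff n φ = 0) : φ = 0 := by
  apply eq_zero_of_hgOp_eq_zero h
  have hstep : ∀ i, i ≤ n → coeff (n - i) φ = 0 := by
    intro i
    induction i with
    | zero => simpa using hn
    | succ i ih =>
      intro hi
      obtain ⟨k, rfl⟩ : ∃ k, n = k + (i + 1) := ⟨n - (i + 1), by omega⟩
      have ih' : coeff (k + 1) φ = 0 := by
        have := ih (by omega)
        rwa [show k + (i + 1) - i = k + 1 by omega] at this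
      rw [show k + (i + 1) - (i + 1) = k by omega]
      have := congrArg (coeff k) h
      rw [coeff_hgOp, ih'] at this
      have hne : ((i : ℂ) + 1) * (2 * k + i + 2) ≠ 0 := by
        exact_mod_cast (by positivity : (i + 1) * (2 * k + i + 2) ≠ 0)
      apply mul_left_cancel₀ hne
      push_cast at this
      simp only [map_zero] at this
      linear_combination this
  simpa using hstep n le_rfl

/-- The numbers `ψ (k + 1)`. -/
noncomputable def natDigamma (k : ℕ) : ℂ := Complex.digamma (k + 1)

theorem natDigamma_succ (k : ℕ) : natDigamma (k + 1) = natDigamma k + 1 / (k + 1) := by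
  rw [natDigamma, natDigamma, one_div]
  push_cast
  refine Complex.digamma_apply_add_one _ fun j => ?_
  intro h
  have : ((k + 1 + j : ℕ) : ℂ) = 0 := by push_cast; linear_combination h
  exact absurd (Nat.cast_eq_zero.1 this) (by omega)

/-- The coefficients of a terminating Gauss series. -/
noncomputable def terminatingCoeff (m N p k : ℕ) : ℂ :=
  if k ≤ N then (-1) ^ k * ((k + p).factorial / (k.factorial * (k + m).factorial * (N - k).factorial))
  else 0

/-- The ratio of consecutive coefficients belongs to F(-N, p + 1; m + 1; w). The factor k - N agrees
with the cut-off at k = N. -/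
theorem terminatingCoeff_succ (m N p k : ℕ) :
    ((k : ℂ) + 1) * (k + (m + 1)) * terminatingCoeff m N p (k + 1)
      = (k - N) * (k + p + 1) * terminatingCoeff m N p k := by
  unfold terminatingCoeff
  rcases lt_trichotomy k N with h | h | h
  · rw [if_pos (by omega : k + 1 ≤ N), if_pos h.le]
    obtain ⟨j, rfl⟩ : ∃ j, N = k + 1 + j := ⟨N - (k + 1), by omega⟩
    rw [show k + 1 + j - (k + 1) = j by omega, show k + 1 + j - k = j + 1 by omega,
      show k + 1 + p = k + p + 1 by ring, show k + 1 + m = k + m + 1 by ring,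
      Nat.factorial_succ k, Nat.factorial_succ j, Nat.factorial_succ (k + p),
      Nat.factorial_succ (k + m)]
    have h1 : ((k : ℂ) + 1) ≠ 0 := Nat.cast_add_one_ne_zero k
    have h2 : ((k : ℂ) + m + 1) ≠ 0 := by norm_cast
    have h3 : ((j : ℂ) + 1) ≠ 0 := Nat.cast_add_one_ne_zero j
    have f1 : (k.factorial : ℂ) ≠ 0 := by exact_mod_cast k.factorial_ne_zero
    have f2 : ((k + m).factorial : ℂ) ≠ 0 := by exact_mod_cast (k + m).factorial_ne_zero
    have f3 : (j.factorial : ℂ) ≠ 0 := by exact_mod_cast j.factorial_ne_zero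
    push_cast
    field_simp
    ring
  · subst h
    simp
  · rw [if_neg (by omega), if_neg (by omega)]
    simp

/-- The series with the coefficients `terminatingCoeff m N p k`. -/
noncomputable def terminatingSeries (m N p : ℕ) : PowerSeries ℂ := mk (terminatingCoeff m N p)

/-- The series with the coefficients `terminatingCoeff m N p k * ψ (k + p + 1)`. -/
noncomputable def terminatingDigammaSeries (m N p : ℕ) : PowerSeries ℂ :=
  mk fun k => terminatingCoeff m N p k * natDigamma (k + p)

theorem hgOp_terminatingSeries (m N p : ℕ) {d q : ℂ} (hd : d = p + 2 - N) (hq : q = N * (p + 1)) :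
    hgOp (m + 1) d q (terminatingSeries m N p) = 0 := by
  ext k
  rw [coeff_hgOp, terminatingSeries, coeff_mk, coeff_mk, terminatingCoeff_succ, hd, hq, map_zero]
  ring

/-- The increment 1/(k + p + 1) of ψ cancels that factor in the coefficient recursion. What remains
is k - N times the coefficient, that is, X d/dX - N applied to the series. -/
theorem hgOp_terminatingDigammaSeries (m N p : ℕ) {d q : ℂ} (hd : d = p + 2 - N)
    (hq : q = N * (p + 1)) :
    hgOp (m + 1) d q (terminatingDigammaSeries m N p)
      = X * d⁄dX ℂ (terminatingSeries m N p) - C (N : ℂ) * terminatingSeries m N p := by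
  ext k
  rw [coeff_hgOp, map_sub, coeff_C_mul, coeff_X_mul_derivative, terminatingDigammaSeries,
    terminatingSeries, coeff_mk, coeff_mk, coeff_mk, ← mul_assoc, terminatingCoeff_succ, hd, hq,
    show k + 1 + p = k + p + 1 by ring, natDigamma_succ]
  have : ((k : ℂ) + p + 1) ≠ 0 := by norm_cast
  push_cast
  field_simp
  ring

end

/-! ### The degree derivative in powers of w -/

section

open PowerSeries

theorem coeff_one_sub_X_pow_mul (m N : ℕ) (φ : PowerSeries ℂ) (hφ : ∀ k, N < k → coeff k φ = 0) :
    coeff (N + m) ((1 - X) ^ m * φ) = (-1) ^ m * coeff N φ := by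
  induction m generalizing N φ with
  | zero => simp
  | succ m ih =>
    have h := ih (N + 1) ((1 - X) * φ) fun k hk => by
      obtain ⟨j, rfl⟩ : ∃ j, k = j + 1 := ⟨k - 1, by omega⟩
      rw [sub_mul, one_mul, map_sub, coeff_succ_X_mul, hφ _ (by omega), hφ _ (by omega), sub_zero]
    rw [pow_succ, mul_assoc, show N + (m + 1) = N + 1 + m by ring, h, sub_mul, one_mul, map_sub,
      coeff_succ_X_mul, hφ _ (by omega), pow_succ]
    ring

theorem coeff_terminatingSeries_of_lt {m N p k : ℕ} (h : N < k) :
    coeff k (terminatingSeries m N p) = 0 := by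
  simp [terminatingSeries, terminatingCoeff, h.not_ge]

theorem coeff_terminatingDigammaSeries_of_lt {m N p k : ℕ} (h : N < k) :
    coeff k (terminatingDigammaSeries m N p) = 0 := by
  simp [terminatingDigammaSeries, terminatingCoeff, h.not_ge]

/-- The polynomial solution of the equation `w (1 - w) Y'' + (m + 1 - 2 w) Y' + n (n + 1) Y = 0`. -/
noncomputable def legendreSeries (n m : ℕ) : PowerSeries ℂ :=
  C ((-1) ^ m) * ((1 - X) ^ m * terminatingSeries m (n - m) (n + m))

theorem hgOp_legendreSeries {n m : ℕ} (h : m ≤ n) :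
    hgOp (m + 1) 2 (n * (n + 1)) (legendreSeries n m) = 0 := by
  rw [legendreSeries, hgOp_C_mul, show (n : ℂ) * (n + 1) = (n - m : ℕ) * ((n + m : ℕ) + 1)
    + m * (m + 1) by push_cast [h]; ring, hgOp_one_sub_X_pow_mul,
    hgOp_terminatingSeries m (n - m) (n + m) (by push_cast [h]; ring) rfl, mul_zero, mul_zero]

/-- Euler's transformation of F(-n, n + 1; m + 1; w): both sides solve the same equation and have
the same constant term. -/
theorem legendreSeries_eq {n m : ℕ} (h : m ≤ n) :
    legendreSeries n m = C ((-1) ^ m * ((n + m).factorial / (n - m).factorial : ℂ))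
      * terminatingSeries m n n := by
  rw [← sub_eq_zero]
  apply eq_zero_of_hgOp_eq_zero (m := m) (d := 2) (q := n * (n + 1))
  · rw [hgOp_sub, hgOp_legendreSeries h, hgOp_C_mul, hgOp_terminatingSeries m n n (by ring) rfl]
    simp
  · have : (n.factorial : ℂ) ≠ 0 := by exact_mod_cast n.factorial_ne_zero
    simp only [legendreSeries, terminatingSeries, map_sub, coeff_zero_eq_constantCoeff, map_mul, map_pow, map_one, constantCoeff_X]
    simp [constantCoeff_mk, terminatingCoeff]
    field_simp
    simp

/-- The polynomial part, in powers of `w`, of the degree derivative of the Legendre function. -/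
noncomputable def degreeDerivSeries (n m : ℕ) : PowerSeries ℂ :=
  C ((-1) ^ m) * ((1 - X) ^ m * terminatingDigammaSeries m (n - m) (n + m)
      + C ((n + m).factorial / (n - m).factorial : ℂ) * terminatingDigammaSeries m n n)
    - C (natDigamma n + natDigamma (n - m)) * legendreSeries n m

theorem one_sub_X_mul_derivative_pow (m : ℕ) :
    (1 - X) * d⁄dX ℂ ((1 - X : PowerSeries ℂ) ^ m) = -(m : PowerSeries ℂ) * (1 - X) ^ m := by
  rw [derivative_pow]
  cases m with
  | zero => simp
  | succ m => simp [pow_succ]; ring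

/-- Each of the two digamma series contributes X Y' - n Y, Y being the polynomial solution. The
first contributes in addition mY/(1 - X), which comes from differentiating (1 - X)^m; multiplying by
1 - X removes this denominator. -/
theorem hgOp_degreeDerivSeries {n m : ℕ} (h : m ≤ n) :
    (1 - X) * hgOp (m + 1) 2 (n * (n + 1)) (degreeDerivSeries n m)
      = (1 - X) * (2 * X * d⁄dX ℂ (legendreSeries n m) - C (2 * (n : ℂ)) * legendreSeries n m)
        + C (m : ℂ) * legendreSeries n m := by
  have hB : C ((-1) ^ m) * (C ((n + m).factorial / (n - m).factorial : ℂ) *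
      (X * d⁄dX ℂ (terminatingSeries m n n) - C (n : ℂ) * terminatingSeries m n n))
      = X * d⁄dX ℂ (legendreSeries n m) - C (n : ℂ) * legendreSeries n m := by
    rw [legendreSeries_eq h]
    simp only [Derivation.leibniz, derivative_C, smul_eq_mul, map_mul]
    ring
  rw [degreeDerivSeries, hgOp_sub, hgOp_C_mul, hgOp_C_mul, hgOp_legendreSeries h, hgOp_add,
    hgOp_C_mul _ _ _ ((n + m).factorial / (n - m).factorial : ℂ),
    hgOp_terminatingDigammaSeries m n n (by ring) rfl, mul_zero, sub_zero, mul_add, hB,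
    show (n : ℂ) * (n + 1) = (n - m : ℕ) * ((n + m : ℕ) + 1) + m * (m + 1) by push_cast [h]; ring,
    hgOp_one_sub_X_pow_mul,
    hgOp_terminatingDigammaSeries m (n - m) (n + m) (by push_cast [h]; ring) rfl]
  have h1 := one_sub_X_mul_derivative_pow m
  simp only [legendreSeries, Derivation.leibniz, derivative_C, smul_eq_mul, Nat.cast_sub h, map_sub,
    map_natCast, map_mul, map_ofNat]
  generalize d⁄dX ℂ ((1 - X : PowerSeries ℂ) ^ m) = e1 at *
  generalize (1 - X : PowerSeries ℂ) ^ m = e at *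
  linear_combination -(C ((-1) ^ m) * X * terminatingSeries m (n - m) (n + m)) * h1

/-- The series of `log (1 - w)`. -/
noncomputable def logOneSubSeries : PowerSeries ℂ := mk fun k => -(1 / k : ℂ)

theorem one_sub_X_mul_derivative_log : (1 - X) * d⁄dX ℂ logOneSubSeries = -1 := by
  ext k
  rw [sub_mul, one_mul, map_sub]
  cases k with
  | zero => simp [logOneSubSeries, coeff_zero_X_mul, coeff_derivative, -coeff_zero_eq_constantCoeff]
  | succ k =>
    have h1 : ((k : ℂ) + 1) ≠ 0 := Nat.cast_add_one_ne_zero k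
    have h2 : ((k : ℂ) + 1 + 1) ≠ 0 := by exact_mod_cast Nat.cast_add_one_ne_zero (R := ℂ) (k + 1)
    simp [logOneSubSeries, coeff_derivative, coeff_succ_X_mul, coeff_one]
    field_simp
    simp

theorem hasPowerSum_logOneSubSeries :
    HasPowerSum logOneSubSeries 1 (fun w => Complex.log (1 - w)) := fun w hw => by
  have := (Complex.hasSum_taylorSeries_neg_log hw).neg
  rw [neg_neg] at this
  refine this.congr_fun fun k => ?_
  simp [logOneSubSeries]
  ring

/-- The operator applied to Y log(1 - X) produces -2X Y' and -(m + 1 - X)Y/(1 - X). Together with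
the image of the polynomial part everything cancels except -(2n + 1)Y, the source term carried by t.
The constant terms agree, so uniqueness applies. -/
theorem one_sub_X_pow_mul_eq {n m : ℕ} (h : m ≤ n) {t K : PowerSeries ℂ}
    (hK : (1 - X : PowerSeries ℂ) ^ m * K = legendreSeries n m)
    (ht : hgOp (m + 1) (2 * m + 2) ((n - m : ℕ) * ((n + m : ℕ) + 1)) t = C (-(2 * n + 1 : ℂ)) * K)
    (h0 : coeff 0 t = coeff 0 (degreeDerivSeries n m)) :
    (1 - X) ^ m * t = legendreSeries n m * logOneSubSeries + degreeDerivSeries n m := by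
  rw [← sub_eq_zero]
  apply eq_zero_of_hgOp_eq_zero (m := m) (d := 2) (q := n * (n + 1))
  · apply mul_left_cancel₀ one_sub_X_ne_zero
    have hV := hgOp_degreeDerivSeries h
    have hY := hgOp_legendreSeries h
    have hℓ := one_sub_X_mul_derivative_log
    have hℓ2 : (1 - X) * d⁄dX ℂ (d⁄dX ℂ logOneSubSeries) = d⁄dX ℂ logOneSubSeries := by
      have := congrArg (d⁄dX ℂ) hℓ
      simp only [Derivation.leibniz, smul_eq_mul, map_sub, derivative_X, map_neg,
        Derivation.map_one_eq_zero] at this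
      linear_combination this
    have e1 : hgOp (m + 1) 2 (n * (n + 1)) ((1 - X) ^ m * t)
        = C (-(2 * n + 1 : ℂ)) * legendreSeries n m := by
      rw [show (n : ℂ) * (n + 1) = (n - m : ℕ) * ((n + m : ℕ) + 1) + m * (m + 1) by
        push_cast [h]; ring, hgOp_one_sub_X_pow_mul, ht, ← hK]
      ring
    have e2 : (1 - X) * hgOp (m + 1) 2 (n * (n + 1)) (legendreSeries n m * logOneSubSeries)
        = -2 * X * (1 - X) * d⁄dX ℂ (legendreSeries n m) - ((m : PowerSeries ℂ) + 1 - X) * legendreSeries n m := by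
      simp only [hgOp, Derivation.leibniz, smul_eq_mul, map_add, map_mul, map_natCast, map_one,
        map_ofNat] at hY ⊢
      linear_combination (1 - X) * logOneSubSeries * hY
        + (X * (1 - X) * legendreSeries n m) * hℓ2
        + (2 * X * (1 - X) * d⁄dX ℂ (legendreSeries n m)
          + ((m : PowerSeries ℂ) + 1 - X) * legendreSeries n m) * hℓ
    rw [hgOp_sub, hgOp_add, e1, mul_sub, mul_add (1 - X : PowerSeries ℂ), hV, e2]
    simp only [map_neg, map_add, map_mul, map_natCast, map_one, map_ofNat]
    ring
  · rw [map_sub, map_add]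
    simp only [coeff_zero_eq_constantCoeff] at h0 ⊢
    simp [h0]
    simp [constantCoeff_mk, logOneSubSeries]

theorem coeff_zero_degreeDerivSeries (n m : ℕ) :
    coeff 0 (degreeDerivSeries n m) = (-1) ^ m * ((n + m).factorial / (m.factorial * (n - m).factorial))
      * (natDigamma (n + m) - natDigamma (n - m)) := by
  have : (n.factorial : ℂ) ≠ 0 := by exact_mod_cast n.factorial_ne_zero
  simp only [degreeDerivSeries, legendreSeries, terminatingSeries, terminatingDigammaSeries, map_sub,
    map_add, coeff_zero_eq_constantCoeff, map_mul, map_pow, map_one, constantCoeff_X,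
    constantCoeff_C]
  simp [constantCoeff_mk, terminatingCoeff]
  field_simp
  ring

end

/-! ### The same polynomials in powers of 1 - w -/

section

open PowerSeries

/-- The hypergeometric operator on polynomials. -/
noncomputable def hgOpPoly (c q : ℂ) (p : Polynomial ℂ) : Polynomial ℂ :=
  .X * (1 - .X) * p.derivative.derivative + (.C c - 2 * .X) * p.derivative + .C q * p

theorem coe_hgOpPoly (c q : ℂ) (p : Polynomial ℂ) :
    (hgOpPoly c q p : PowerSeries ℂ) = hgOp c 2 q p := by
  have h2 : ((2 : Polynomial ℂ) : PowerSeries ℂ) = 2 := by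
    rw [← map_ofNat (Polynomial.C : ℂ →+* _) 2, Polynomial.coe_C, map_ofNat]
  simp only [hgOpPoly, hgOp, derivative_coe, Polynomial.coe_add, Polynomial.coe_mul,
    Polynomial.coe_sub, Polynomial.coe_X, Polynomial.coe_C, Polynomial.coe_one, h2, map_ofNat]

theorem coeff_hgOpPoly (c q : ℂ) (p : Polynomial ℂ) (k : ℕ) :
    (hgOpPoly c q p).coeff k =
      (k + 1) * (k + c) * p.coeff (k + 1) - (k * (k - 1) + 2 * k - q) * p.coeff k := by
  rw [← Polynomial.coeff_coe, coe_hgOpPoly, coeff_hgOp, Polynomial.coeff_coe, Polynomial.coeff_coe]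

/-- The reflection w ↦ 1 - w exchanges the singular points 0 and 1, which replaces c by 2 - c. -/
theorem hgOpPoly_comp (m : ℕ) (q : ℂ) (p : Polynomial ℂ) :
    hgOpPoly (m + 1) q (p.comp (1 - .X)) = (hgOpPoly (1 - m) q p).comp (1 - .X) := by
  simp only [hgOpPoly, Polynomial.derivative_comp, Polynomial.derivative_mul, Polynomial.add_comp,
    Polynomial.mul_comp, Polynomial.sub_comp, Polynomial.X_comp, Polynomial.C_comp,
    Polynomial.one_comp, map_add, map_sub, map_natCast, map_one, Polynomial.ofNat_comp,
    Polynomial.natCast_comp, Polynomial.derivative_one, Polynomial.derivative_X,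
    Polynomial.derivative_zero]
  ring

/-- The coefficients, in powers of `1 - w`, of the polynomial solution. -/
noncomputable def reflectedCoeff (n m j : ℕ) : ℂ :=
  if j < m then 0 else terminatingCoeff m (n - m) (n + m) (j - m)

/-- The coefficients, in powers of `1 - w`, of the polynomial part of the degree derivative. -/
noncomputable def reflectedDerivCoeff (n m j : ℕ) : ℂ :=
  if j < m then -((j + n).factorial * (m - j - 1).factorial / (j.factorial * (n - j).factorial))
  else terminatingCoeff m (n - m) (n + m) (j - m)
    * (2 * natDigamma (j + n) - natDigamma j - natDigamma (j - m))

/-- The polynomial of degree at most `n` with the given coefficients. -/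
noncomputable def polyOfCoeff (n : ℕ) (y : ℕ → ℂ) : Polynomial ℂ :=
  ∑ j ∈ Finset.range (n + 1), Polynomial.monomial j (y j)

theorem coeff_polyOfCoeff {n : ℕ} {y : ℕ → ℂ} (hy : ∀ j, n < j → y j = 0) (k : ℕ) :
    (polyOfCoeff n y).coeff k = y k := by
  simp only [polyOfCoeff, Polynomial.finsetSum_coeff, Polynomial.coeff_monomial]
  rw [Finset.sum_ite_eq']
  split_ifs with h
  · rfl
  · exact (hy k (by simpa [Nat.lt_succ_iff] using h)).symm

theorem coeff_polyOfCoeff_comp (n : ℕ) (y : ℕ → ℂ) :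
    ((polyOfCoeff n y).comp (1 - .X)).coeff n = (-1) ^ n * y n := by
  have hdeg : (1 - .X : Polynomial ℂ).natDegree ≤ 1 :=
    (Polynomial.natDegree_sub_le _ _).trans (by simp)
  have h0 : ∀ j < n, ((1 - .X : Polynomial ℂ) ^ j).coeff n = 0 := fun j hj =>
    Polynomial.coeff_eq_zero_of_natDegree_lt
      ((Polynomial.natDegree_pow_le_of_le j hdeg).trans_lt (by simpa using hj))
  have h1 : ((1 - .X : Polynomial ℂ) ^ n).coeff n = (-1) ^ n := by
    have := Polynomial.coeff_pow_of_natDegree_le (m := n) hdeg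
    rw [mul_one] at this
    rw [this]
    simp [Polynomial.coeff_one]
  rw [polyOfCoeff, Polynomial.sum_comp, Polynomial.finsetSum_coeff,
    Finset.sum_range_succ, Finset.sum_eq_zero, zero_add]
  · rw [Polynomial.monomial_comp, Polynomial.coeff_C_mul, h1, mul_comm]
  · intro j hj
    rw [Polynomial.monomial_comp, Polynomial.coeff_C_mul, h0 j (Finset.mem_range.1 hj), mul_zero]

variable {n m : ℕ}

theorem reflectedCoeff_of_lt (h : m ≤ n) (j : ℕ) (hj : n < j) : reflectedCoeff n m j = 0 := by
  rw [reflectedCoeff, if_neg (by omega), terminatingCoeff, if_neg (by omega)]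

theorem reflectedDerivCoeff_of_lt (h : m ≤ n) (j : ℕ) (hj : n < j) :
    reflectedDerivCoeff n m j = 0 := by
  rw [reflectedDerivCoeff, if_neg (by omega), terminatingCoeff, if_neg (by omega), zero_mul]

theorem reflectedCoeff_succ (h : m ≤ n) (j : ℕ) :
    ((j : ℂ) + 1) * (j + (1 - m)) * reflectedCoeff n m (j + 1)
      = (j * (j - 1) + 2 * j - n * (n + 1)) * reflectedCoeff n m j := by
  rcases lt_trichotomy (j + 1) m with hj | hj | hj
  · simp [reflectedCoeff, hj, (Nat.lt_succ_self j).trans hj]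
  · have : (j : ℂ) + (1 - m) = 0 := by rw [← hj]; push_cast; ring
    rw [this, reflectedCoeff, reflectedCoeff, if_pos (by omega : j < m)]
    ring
  · obtain ⟨k, rfl⟩ : ∃ k, j = k + m := ⟨j - m, by omega⟩
    have := terminatingCoeff_succ m (n - m) (n + m) k
    rw [reflectedCoeff, reflectedCoeff, if_neg (by omega), if_neg (by omega),
      show k + m + 1 - m = k + 1 by omega, Nat.add_sub_cancel]
    push_cast [h] at this ⊢
    linear_combination this

/-- The coefficients for j < m continue the formula for j ≥ m: there -ψ(j - m + 1)/Γ(j - m + 1) has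
a finite limit, namely (m - j - 1)! up to sign. For j ≥ m the identity is the recurrence of ψ. -/
theorem reflectedDerivCoeff_succ (h : m ≤ n) (j : ℕ) :
    ((j : ℂ) + 1) * (j + (1 - m)) * reflectedDerivCoeff n m (j + 1)
        - (j * (j - 1) + 2 * j - n * (n + 1)) * reflectedDerivCoeff n m j
      = 2 * (j - n) * reflectedCoeff n m j - (2 * j + 2 - m) * reflectedCoeff n m (j + 1) := by
  rcases lt_trichotomy (j + 1) m with hj | hj | hj
  · rw [reflectedDerivCoeff, reflectedDerivCoeff, reflectedCoeff, reflectedCoeff, if_pos hj,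
      if_pos hj, if_pos (by omega), if_pos (by omega)]
    obtain ⟨i, rfl⟩ : ∃ i, m = j + 1 + 1 + i := ⟨m - (j + 2), by omega⟩
    obtain ⟨k, rfl⟩ : ∃ k, n = j + 1 + 1 + i + k := ⟨n - (j + 1 + 1 + i), by omega⟩
    rw [show j + 1 + 1 + i - (j + 1) - 1 = i by omega, show j + 1 + 1 + i - j - 1 = i + 1 by omega,
      show j + 1 + 1 + i + k - (j + 1) = i + k + 1 by omega,
      show j + 1 + 1 + i + k - j = i + k + 1 + 1 by omega,
      show j + 1 + (j + 1 + 1 + i + k) = j + (j + 1 + 1 + i + k) + 1 by ring,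
      Nat.factorial_succ (j + (j + 1 + 1 + i + k)), Nat.factorial_succ (i + k + 1),
      Nat.factorial_succ j, Nat.factorial_succ i]
    have f1 : (j.factorial : ℂ) ≠ 0 := by exact_mod_cast j.factorial_ne_zero
    have f2 : ((i + k + 1).factorial : ℂ) ≠ 0 := by exact_mod_cast (i + k + 1).factorial_ne_zero
    have h1 : ((j : ℂ) + 1) ≠ 0 := Nat.cast_add_one_ne_zero j
    have h2 : ((i : ℂ) + k + 1 + 1) ≠ 0 := by norm_cast
    push_cast
    field_simp
    ring
  -- At the resonance j + 1 = m the factor of the next coefficient vanishes. The last coefficient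
  -- below m must then balance the source term, and this fixes the scale of the finite sum.
  · have h0 : (j : ℂ) + (1 - m) = 0 := by rw [← hj]; push_cast; ring
    rw [h0, reflectedDerivCoeff, reflectedDerivCoeff, reflectedCoeff, reflectedCoeff,
      if_pos (by omega : j < m), if_pos (by omega : j < m), if_neg (by omega), if_neg (by omega)]
    obtain ⟨k, rfl⟩ : ∃ k, n = j + 1 + k := ⟨n - (j + 1), by omega⟩
    subst hj
    rw [show j + 1 - (j + 1) = 0 by omega, show j + 1 - j - 1 = 0 by omega,
      show j + 1 + k - j = k + 1 by omega, terminatingCoeff, if_pos (Nat.zero_le _),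
      show j + 1 + k - (j + 1) - 0 = k by omega,
      show 0 + (j + 1 + k + (j + 1)) = j + (j + 1 + k) + 1 by ring,
      Nat.factorial_succ (j + (j + 1 + k)), Nat.factorial_succ k, show 0 + (j + 1) = j + 1 by ring,
      Nat.factorial_succ j]
    have f1 : (j.factorial : ℂ) ≠ 0 := by exact_mod_cast j.factorial_ne_zero
    have f2 : (k.factorial : ℂ) ≠ 0 := by exact_mod_cast k.factorial_ne_zero
    have h1 : ((j : ℂ) + 1) ≠ 0 := Nat.cast_add_one_ne_zero j
    have h2 : ((k : ℂ) + 1) ≠ 0 := Nat.cast_add_one_ne_zero k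
    push_cast
    simp only [Nat.factorial_zero, Nat.cast_one]
    field_simp
    ring
  · obtain ⟨k, rfl⟩ : ∃ k, j = k + m := ⟨j - m, by omega⟩
    have R := terminatingCoeff_succ m (n - m) (n + m) k
    rw [reflectedDerivCoeff, reflectedDerivCoeff, reflectedCoeff, reflectedCoeff,
      if_neg (by omega : ¬ k + m + 1 < m), if_neg (by omega : ¬ k + m + 1 < m),
      if_neg (by omega), if_neg (by omega),
      show k + m + 1 - m = k + 1 by omega, Nat.add_sub_cancel,
      show k + m + 1 + n = k + m + n + 1 by ring, natDigamma_succ, natDigamma_succ, natDigamma_succ]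
    generalize terminatingCoeff m (n - m) (n + m) (k + 1) = s' at *
    generalize terminatingCoeff m (n - m) (n + m) k = s at *
    have ha : (1 / ((k + m + n : ℕ) + 1) : ℂ) * (k + m + n + 1) = 1 := by
      push_cast; exact one_div_mul_cancel (by norm_cast)
    have hb : (1 / ((k + m : ℕ) + 1) : ℂ) * (k + m + 1) = 1 := by
      push_cast; exact one_div_mul_cancel (by norm_cast)
    have hc : (1 / ((k : ℕ) + 1) : ℂ) * (k + 1) = 1 :=
      one_div_mul_cancel (Nat.cast_add_one_ne_zero k)
    generalize (1 / ((k + m + n : ℕ) + 1) : ℂ) = a at *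
    generalize (1 / ((k + m : ℕ) + 1) : ℂ) = b at *
    generalize (1 / ((k : ℕ) + 1) : ℂ) = c at *
    push_cast [h] at R ⊢
    linear_combination (2 * natDigamma (k + m + n) - natDigamma (k + m) - natDigamma k + 2 * a) * R
      + 2 * (k - (n - m)) * s * ha - (k + 1) * s' * hb - (k + m + 1) * s' * hc

theorem coeff_X_mul_derivative_poly (p : Polynomial ℂ) (k : ℕ) :
    (.X * p.derivative : Polynomial ℂ).coeff k = k * p.coeff k := by
  rw [← Polynomial.coeff_coe, Polynomial.coe_mul, Polynomial.coe_X, ← derivative_coe,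
    coeff_X_mul_derivative, Polynomial.coeff_coe]

theorem hgOpPoly_reflected (h : m ≤ n) :
    .X * hgOpPoly (1 - m) (n * (n + 1)) (polyOfCoeff n (reflectedDerivCoeff n m))
      = .X * (.C 2 * (.X * (polyOfCoeff n (reflectedCoeff n m)).derivative)
          - .C (2 * (n : ℂ)) * polyOfCoeff n (reflectedCoeff n m)
          - .C 2 * (polyOfCoeff n (reflectedCoeff n m)).derivative)
        + .C (m : ℂ) * polyOfCoeff n (reflectedCoeff n m) := by
  ext j
  rw [Polynomial.coeff_add, Polynomial.coeff_C_mul, coeff_polyOfCoeff (reflectedCoeff_of_lt h)]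
  cases j with
  | zero =>
    rw [Polynomial.mul_coeff_zero, Polynomial.mul_coeff_zero, Polynomial.coeff_X_zero, zero_mul,
      zero_mul, zero_add, reflectedCoeff]
    split_ifs with h0
    · simp
    · simp [show m = 0 by omega]
  | succ j =>
    rw [Polynomial.coeff_X_mul, Polynomial.coeff_X_mul, Polynomial.coeff_sub, Polynomial.coeff_sub,
      Polynomial.coeff_C_mul, Polynomial.coeff_C_mul, Polynomial.coeff_C_mul,
      coeff_X_mul_derivative_poly, Polynomial.coeff_derivative, coeff_hgOpPoly,
      coeff_polyOfCoeff (reflectedCoeff_of_lt h), coeff_polyOfCoeff (reflectedCoeff_of_lt h),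
      coeff_polyOfCoeff (reflectedDerivCoeff_of_lt h),
      coeff_polyOfCoeff (reflectedDerivCoeff_of_lt h), reflectedDerivCoeff_succ h]
    ring

/-- After reflection the exponents at 0 are 0 and m, and the polynomial belongs to m. Both sides
solve the same equation, so their coefficients of X^n decide. -/
theorem legendreSeries_eq_comp (h : m ≤ n) :
    legendreSeries n m = C ((-1) ^ n)
      * (((polyOfCoeff n (reflectedCoeff n m)).comp (1 - .X) : Polynomial ℂ) : PowerSeries ℂ) := by
  rw [← sub_eq_zero]
  apply eq_zero_of_hgOp_eq_zero_of_coeff (m := m) (n := n)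
  · rw [hgOp_sub, hgOp_legendreSeries h, hgOp_C_mul, ← coe_hgOpPoly, hgOpPoly_comp,
      show hgOpPoly (1 - m) (n * (n + 1)) (polyOfCoeff n (reflectedCoeff n m)) = 0 from ?_]
    · simp
    · ext j
      rw [coeff_hgOpPoly, coeff_polyOfCoeff (reflectedCoeff_of_lt h),
        coeff_polyOfCoeff (reflectedCoeff_of_lt h), reflectedCoeff_succ h]
      simp
  · have h1 := coeff_one_sub_X_pow_mul m (n - m) (terminatingSeries m (n - m) (n + m))
      fun k hk => coeff_terminatingSeries_of_lt hk
    rw [Nat.sub_add_cancel h] at h1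
    rw [legendreSeries, map_sub, coeff_C_mul, coeff_C_mul, Polynomial.coeff_coe,
      coeff_polyOfCoeff_comp, h1, terminatingSeries, coeff_mk, reflectedCoeff,
      if_neg (by omega), ← mul_assoc, ← mul_assoc, ← mul_pow, ← mul_pow]
    simp

/-- Both sides solve the same inhomogeneous equation, so it remains to compare the coefficients of
X^n. -/
theorem degreeDerivSeries_eq_comp (h : m ≤ n) :
    degreeDerivSeries n m = C ((-1) ^ n)
      * (((polyOfCoeff n (reflectedDerivCoeff n m)).comp (1 - .X) : Polynomial ℂ) :
        PowerSeries ℂ) := by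
  rw [← sub_eq_zero]
  apply eq_zero_of_hgOp_eq_zero_of_coeff (m := m) (n := n)
  · apply mul_left_cancel₀ one_sub_X_ne_zero
    have hode := congrArg (fun p : Polynomial ℂ => ((p.comp (1 - .X) : Polynomial ℂ) :
      PowerSeries ℂ)) (hgOpPoly_reflected h)
    have hY := legendreSeries_eq_comp h
    have hdY : d⁄dX ℂ (legendreSeries n m) = -C ((-1) ^ n)
        * (((polyOfCoeff n (reflectedCoeff n m)).derivative.comp (1 - .X) : Polynomial ℂ) :
          PowerSeries ℂ) := by
      rw [hY, Derivation.leibniz, derivative_C, derivative_coe, Polynomial.derivative_comp]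
      simp
    rw [hgOp_sub, hgOp_C_mul, ← coe_hgOpPoly, hgOpPoly_comp, mul_sub, hgOp_degreeDerivSeries h,
      hdY, hY]
    simp only [Polynomial.mul_comp, Polynomial.add_comp, Polynomial.sub_comp, Polynomial.X_comp,
      Polynomial.C_comp, Polynomial.coe_mul, Polynomial.coe_add, Polynomial.coe_sub,
      Polynomial.coe_X, Polynomial.coe_one, Polynomial.coe_C] at hode
    simp only [map_ofNat] at hode
    linear_combination -C ((-1) ^ n) * hode
  · have h1 := coeff_one_sub_X_pow_mul m (n - m) (terminatingDigammaSeries m (n - m) (n + m))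
      fun k hk => coeff_terminatingDigammaSeries_of_lt hk
    have h2 := congrArg (coeff n) (legendreSeries_eq h)
    have h3 := congrArg (coeff n) (legendreSeries_eq_comp h)
    rw [Nat.sub_add_cancel h] at h1
    rw [coeff_C_mul] at h2
    rw [coeff_C_mul, Polynomial.coeff_coe, coeff_polyOfCoeff_comp, reflectedCoeff,
      if_neg (by omega), ← mul_assoc] at h3
    rw [degreeDerivSeries, map_sub, map_sub, coeff_C_mul, coeff_C_mul, coeff_C_mul, map_add,
      coeff_C_mul, Polynomial.coeff_coe, coeff_polyOfCoeff_comp, h1, reflectedDerivCoeff,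
      if_neg (by omega)]
    simp only [terminatingDigammaSeries, terminatingSeries, coeff_mk] at h2 ⊢
    -- In degree n both digamma series carry ψ(2n + 1). Either side is therefore the top coefficient
    -- of the Legendre polynomial times 2ψ(2n + 1) - ψ(n + 1) - ψ(n - m + 1).
    rw [show n - m + (n + m) = n + n by omega]
    have e1 : ((-1 : ℂ) ^ m * (-1) ^ m) = 1 := by rw [← mul_pow]; simp
    have e2 : ((-1 : ℂ) ^ n * (-1) ^ n) = 1 := by rw [← mul_pow]; simp
    generalize (-1 : ℂ) ^ m = x at *
    generalize (-1 : ℂ) ^ n = y at *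
    linear_combination terminatingCoeff m (n - m) (n + m) (n - m) * natDigamma (n + n) * e1
      - natDigamma (n + n) * h2 - terminatingCoeff m (n - m) (n + m) (n - m)
        * (2 * natDigamma (n + n) - natDigamma n - natDigamma (n - m)) * e2
      + (natDigamma (n + n) - natDigamma n - natDigamma (n - m))
        * (h3 + terminatingCoeff m (n - m) (n + m) (n - m) * e2)

end

/-! ### The regularized Gauss function and its degree derivative on the cut plane -/

section

open PowerSeries

theorem isPreconnected_cutPlane : IsPreconnected cutPlane := by
  have himg : cutPlane = (fun w => 1 - w) '' Complex.slitPlane := by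
    ext w
    constructor
    · intro h
      exact ⟨1 - w, h, by ring⟩
    · rintro ⟨v, hv, rfl⟩
      simpa [cutPlane] using hv
  rw [himg]
  exact (Complex.starConvex_one_slitPlane.isPathConnected
    Complex.one_mem_slitPlane).isConnected.isPreconnected.image _
    (continuous_const.sub continuous_id).continuousOn

/-- The leading coefficient of `₂F₁(-ν, ν + 1; 1 - m; w) / Γ(1 - m)`. -/
noncomputable def leadCoeff (m : ℕ) (ν : ℂ) : ℂ :=
  (ascPochhammer ℂ m).eval (-ν) * (ascPochhammer ℂ m).eval (ν + 1) / m.factorial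

theorem leadCoeff_succ (m : ℕ) (ν : ℂ) :
    leadCoeff (m + 1) ν = leadCoeff m ν * ((m - ν) * (ν + m + 1)) / (m + 1) := by
  simp only [leadCoeff, ascPochhammer_succ_eval, Nat.factorial_succ]
  push_cast
  have h1 : ((m : ℂ) + 1) ≠ 0 := Nat.cast_add_one_ne_zero m
  have h2 : (m.factorial : ℂ) ≠ 0 := by exact_mod_cast m.factorial_ne_zero
  field_simp
  ring

/-- The product `a b` for the shifted parameters `a = m - ν`, `b = ν + m + 1`. -/
noncomputable def paramProd (m : ℕ) (ν : ℂ) : ℂ := (m - ν) * (ν + m + 1)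

/-- The continuation of `₂F₁(-ν, ν + 1; 1 - m; w) / Γ(1 - m)`, divided by `w ^ m`. -/
noncomputable def reducedGauss (m : ℕ) (ν w : ℂ) : ℂ :=
  leadCoeff m ν * gaussCut m (paramProd m ν) w

/-- Past the m vanishing coefficients the lower parameter effectively becomes m + 1 and the upper
ones m - ν and ν + m + 1. -/
theorem coeff_regularizedGaussHGFunSeries_add (m : ℕ) (ν : ℂ) (j : ℕ) :
    (Complex.regularizedGaussHGFunSeries (-ν) (ν + 1) (1 - m)).coeff (j + m)
      = leadCoeff m ν * gaussCoeff m (paramProd m ν) j := by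
  rw [Complex.coeff_regularizedGaussHGFunSeries,
    show (1 - m + (j + m : ℕ) : ℂ) = j + 1 by push_cast; ring, Complex.Gamma_nat_eq_factorial]
  induction j with
  | zero => simp [leadCoeff, gaussCoeff_zero]
  | succ j ih =>
    have h1 : ((j : ℂ) + 1) * (j + 1 + m) ≠ 0 := by
      exact_mod_cast (by positivity : (j + 1) * (j + 1 + m) ≠ 0)
    have h2 : ((j + m).factorial : ℂ) ≠ 0 := by exact_mod_cast (j + m).factorial_ne_zero
    have h3 : (j.factorial : ℂ) ≠ 0 := by exact_mod_cast j.factorial_ne_zero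
    have h4 : ((j : ℂ) + m + 1) ≠ 0 := by norm_cast
    have h5 : ((j : ℂ) + 1) ≠ 0 := Nat.cast_add_one_ne_zero j
    apply mul_left_cancel₀ h1
    rw [mul_left_comm, gaussCoeff_succ, mul_left_comm, ← ih, show j + 1 + m = j + m + 1 by ring,
      ascPochhammer_succ_eval, ascPochhammer_succ_eval, Nat.factorial_succ, Nat.factorial_succ,
      paramProd]
    push_cast
    field_simp
    ring

theorem coeff_regularizedGaussHGFunSeries_of_lt {m k : ℕ} (a b : ℂ) (h : k < m) :
    (Complex.regularizedGaussHGFunSeries a b (1 - m)).coeff k = 0 := by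
  rw [Complex.coeff_regularizedGaussHGFunSeries, show (1 - m + k : ℂ) = -((m - 1 - k : ℕ) : ℂ) by
    rw [Nat.cast_sub (by omega), Nat.cast_sub (by omega)]; push_cast; ring,
    Complex.Gamma_neg_nat_eq_zero]
  simp

theorem isGaussContinuation_reducedGauss (m : ℕ) (ν : ℂ) :
    IsGaussContinuation (-ν) (ν + 1) (1 - m) (fun w => w ^ m * reducedGauss m ν w) := by
  refine ⟨?_, fun w hw => ?_⟩
  · exact (differentiableOn_id.pow m).mul
      ((differentiableOn_gaussCut m (paramProd m ν)).const_mul _)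
  · have h := ((hasPowerSum_gaussCut m (paramProd m ν)) w hw).mul_left (w ^ m * leadCoeff m ν)
    have h2 : HasSum (fun k => (Complex.regularizedGaussHGFunSeries (-ν) (ν + 1) (1 - m)).coeff k
        * w ^ k) (w ^ m * reducedGauss m ν w) := by
      rw [← hasSum_nat_add_iff' m, Finset.sum_eq_zero fun k hk => by
        rw [coeff_regularizedGaussHGFunSeries_of_lt _ _ (Finset.mem_range.1 hk), zero_mul],
        sub_zero, reducedGauss, ← mul_assoc]
      refine h.congr_fun fun k => ?_
      rw [coeff_regularizedGaussHGFunSeries_add, coeff_mk]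
      ring
    change w ^ m * reducedGauss m ν w = _
    rw [Complex.regularizedGaussHGFun, FormalMultilinearSeries.sum, ← h2.tsum_eq]
    refine tsum_congr fun k => ?_
    rw [FormalMultilinearSeries.apply_eq_pow_smul_coeff, smul_eq_mul, mul_comm]

theorem gaussRegularized_eq (m : ℕ) (ν : ℂ) {w : ℂ} (hw : w ∈ cutPlane) :
    gaussRegularized (-ν) (ν + 1) (1 - m) w = w ^ m * reducedGauss m ν w := by
  have h : ∃ f, IsGaussContinuation (-ν) (ν + 1) (1 - m) f :=
    ⟨_, isGaussContinuation_reducedGauss m ν⟩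
  rw [gaussRegularized, dif_pos h]
  exact h.choose_spec.eqOn (isGaussContinuation_reducedGauss m ν) hw

theorem leadCoeff_natCast {n m : ℕ} (h : m ≤ n) :
    leadCoeff m n = (-1) ^ m * ((n + m).factorial / (m.factorial * (n - m).factorial)) := by
  induction m with
  | zero =>
    have : (n.factorial : ℂ) ≠ 0 := by exact_mod_cast n.factorial_ne_zero
    simp [leadCoeff, this]
  | succ m ih =>
    obtain ⟨k, rfl⟩ : ∃ k, n = m + 1 + k := ⟨n - (m + 1), by omega⟩
    rw [leadCoeff_succ, ih (by omega), show m + 1 + k - m = k + 1 by omega,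
      show m + 1 + k - (m + 1) = k by omega, show m + 1 + k + (m + 1) = m + 1 + k + m + 1 by ring,
      Nat.factorial_succ (m + 1 + k + m), Nat.factorial_succ k, Nat.factorial_succ m]
    have h1 : ((m : ℂ) + 1) ≠ 0 := Nat.cast_add_one_ne_zero m
    have h2 : (m.factorial : ℂ) ≠ 0 := by exact_mod_cast m.factorial_ne_zero
    have h3 : ((k : ℂ) + 1) ≠ 0 := Nat.cast_add_one_ne_zero k
    have h4 : (k.factorial : ℂ) ≠ 0 := by exact_mod_cast k.factorial_ne_zero
    push_cast
    field_simp
    ring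

/-- The logarithmic derivatives of the factors (j - ν)(ν + j + 1), j < m, at ν = n telescope into a
difference of digamma values; m ≤ n keeps these factors nonzero. -/
theorem hasDerivAt_leadCoeff {n m : ℕ} (h : m ≤ n) :
    HasDerivAt (leadCoeff m) (leadCoeff m n * (natDigamma (n + m) - natDigamma (n - m))) n := by
  induction m with
  | zero =>
    have : leadCoeff 0 = fun _ => 1 := by ext; simp [leadCoeff]
    rw [this]
    simpa using hasDerivAt_const (n : ℂ) (1 : ℂ)
  | succ m ih =>
    have e : leadCoeff (m + 1) = fun ν => leadCoeff m ν * ((m - ν) * (ν + m + 1)) / (m + 1) := by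
      ext ν; exact leadCoeff_succ m ν
    have hd := ((ih (by omega)).mul (((hasDerivAt_id (n : ℂ)).const_sub (m : ℂ)).mul
      (((hasDerivAt_id (n : ℂ)).add_const (m : ℂ)).add_const 1))).div_const ((m : ℂ) + 1)
    rw [leadCoeff_succ]
    rw [e]
    refine hd.congr_deriv ?_
    obtain ⟨k, rfl⟩ : ∃ k, n = m + 1 + k := ⟨n - (m + 1), by omega⟩
    rw [show m + 1 + k - m = k + 1 by omega, show m + 1 + k - (m + 1) = k by omega,
      show m + 1 + k + (m + 1) = m + 1 + k + m + 1 by ring, natDigamma_succ k,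
      natDigamma_succ (m + 1 + k + m)]
    have h1 : ((m : ℂ) + 1) ≠ 0 := Nat.cast_add_one_ne_zero m
    have h3 : ((k : ℂ) + 1) ≠ 0 := Nat.cast_add_one_ne_zero k
    have h4 : ((m : ℂ) + 1 + k + m + 1) ≠ 0 := by norm_cast
    simp only [id, Pi.mul_apply]
    push_cast
    field_simp
    ring

theorem hasDerivAt_paramProd (m n : ℕ) : HasDerivAt (paramProd m) (-(2 * n + 1)) n := by
  have := ((hasDerivAt_id (n : ℂ)).const_sub (m : ℂ)).mul
      (((hasDerivAt_id (n : ℂ)).add_const (m : ℂ)).add_const 1)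
  refine this.congr_deriv ?_
  simp only [id]
  ring

/-- The derivative of `reducedGauss` with respect to `ν`, at `ν = n`. -/
noncomputable def reducedGaussDeriv (n m : ℕ) (w : ℂ) : ℂ :=
  leadCoeff m n * (natDigamma (n + m) - natDigamma (n - m)) * gaussCut m (paramProd m n) w
    + -(2 * n + 1) * leadCoeff m n * gaussCutDeriv m (paramProd m n) w

theorem hasDerivAt_reducedGauss {n m : ℕ} (h : m ≤ n) {w : ℂ} (hw : w ∈ cutPlane) :
    HasDerivAt (fun ν => reducedGauss m ν w) (reducedGaussDeriv n m w) n := by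
  have h1 : HasDerivAt (fun ν => gaussCut m (paramProd m ν) w) _ (n : ℂ) :=
    (hasDerivAt_gaussCut_param m (paramProd m n) hw).comp (n : ℂ) (hasDerivAt_paramProd m n)
  refine ((hasDerivAt_leadCoeff h).mul h1).congr_deriv ?_
  rw [reducedGaussDeriv]
  ring

theorem hasPowerSum_one (R : ℝ) : HasPowerSum 1 R (fun _ => 1) := fun x _ => by
  have := hasSum_single (f := fun k => coeff k (1 : PowerSeries ℂ) * x ^ k) 0
    fun k hk => by simp [coeff_one, hk]
  simpa using this

theorem hasPowerSum_polynomial (p : Polynomial ℂ) (R : ℝ) :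
    HasPowerSum (p : PowerSeries ℂ) R (fun x => p.eval x) := by
  simpa using (hasPowerSum_one R).poly_mul p

/-- The polynomial with the coefficients `terminatingCoeff m N p k`. -/
noncomputable def terminatingPoly (m N p : ℕ) : Polynomial ℂ :=
  polyOfCoeff N (terminatingCoeff m N p)

/-- The polynomial with the coefficients `terminatingCoeff m N p k * ψ (k + p + 1)`. -/
noncomputable def terminatingDigammaPoly (m N p : ℕ) : Polynomial ℂ :=
  polyOfCoeff N fun k => terminatingCoeff m N p k * natDigamma (k + p)

theorem coe_terminatingPoly (m N p : ℕ) :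
    (terminatingPoly m N p : PowerSeries ℂ) = terminatingSeries m N p := by
  ext k
  rw [Polynomial.coeff_coe, terminatingPoly, coeff_polyOfCoeff fun j hj => by
    simp [terminatingCoeff, hj.not_ge], terminatingSeries, coeff_mk]

theorem coe_terminatingDigammaPoly (m N p : ℕ) :
    (terminatingDigammaPoly m N p : PowerSeries ℂ) = terminatingDigammaSeries m N p := by
  ext k
  rw [Polynomial.coeff_coe, terminatingDigammaPoly, coeff_polyOfCoeff fun j hj => by
    simp [terminatingCoeff, hj.not_ge], terminatingDigammaSeries, coeff_mk]

/-- The polynomial `legendreSeries`. -/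
noncomputable def legendrePoly (n m : ℕ) : Polynomial ℂ :=
  .C ((-1) ^ m) * ((1 - .X) ^ m * terminatingPoly m (n - m) (n + m))

/-- The polynomial `degreeDerivSeries`. -/
noncomputable def degreeDerivPoly (n m : ℕ) : Polynomial ℂ :=
  .C ((-1) ^ m) * ((1 - .X) ^ m * terminatingDigammaPoly m (n - m) (n + m)
      + .C ((n + m).factorial / (n - m).factorial : ℂ) * terminatingDigammaPoly m n n)
    - .C (natDigamma n + natDigamma (n - m)) * legendrePoly n m

theorem coe_legendrePoly (n m : ℕ) : (legendrePoly n m : PowerSeries ℂ) = legendreSeries n m := by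
  simp only [legendrePoly, legendreSeries, ← coe_terminatingPoly, Polynomial.coe_mul,
    Polynomial.coe_C, Polynomial.coe_pow, Polynomial.coe_sub, Polynomial.coe_X, Polynomial.coe_one]

theorem coe_degreeDerivPoly (n m : ℕ) :
    (degreeDerivPoly n m : PowerSeries ℂ) = degreeDerivSeries n m := by
  simp only [degreeDerivPoly, degreeDerivSeries, ← coe_terminatingDigammaPoly, ← coe_legendrePoly,
    Polynomial.coe_mul, Polynomial.coe_C, Polynomial.coe_pow, Polynomial.coe_sub, Polynomial.coe_X,
    Polynomial.coe_one, Polynomial.coe_add]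

theorem legendrePoly_eq_comp {n m : ℕ} (h : m ≤ n) :
    legendrePoly n m = .C ((-1) ^ n) * (polyOfCoeff n (reflectedCoeff n m)).comp (1 - .X) := by
  apply Polynomial.coe_injective
  rw [coe_legendrePoly, legendreSeries_eq_comp h, Polynomial.coe_mul, Polynomial.coe_C]

theorem degreeDerivPoly_eq_comp {n m : ℕ} (h : m ≤ n) :
    degreeDerivPoly n m
      = .C ((-1) ^ n) * (polyOfCoeff n (reflectedDerivCoeff n m)).comp (1 - .X) := by
  apply Polynomial.coe_injective
  rw [coe_degreeDerivPoly, degreeDerivSeries_eq_comp h, Polynomial.coe_mul, Polynomial.coe_C]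

theorem C_leadCoeff_mul_mk_gaussCoeff {n m : ℕ} (h : m ≤ n) :
    C (leadCoeff m n) * mk (gaussCoeff m (paramProd m n))
      = C ((-1) ^ m) * terminatingSeries m (n - m) (n + m) := by
  rw [← sub_eq_zero]
  apply eq_zero_of_hgOp_eq_zero (m := m) (d := 2 * m + 2) (q := (n - m : ℕ) * ((n + m : ℕ) + 1))
  · rw [hgOp_sub, hgOp_C_mul, hgOp_C_mul,
      hgOp_terminatingSeries m (n - m) (n + m) (by push_cast [h]; ring) rfl,
      show hgOp (m + 1) (2 * m + 2) ((n - m : ℕ) * ((n + m : ℕ) + 1))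
        (mk (gaussCoeff m (paramProd m n))) = 0 from ?_]
    · simp
    · ext k
      have := gaussCoeff_succ m (paramProd m n) k
      rw [coeff_hgOp, coeff_mk, coeff_mk, map_zero]
      rw [paramProd] at this ⊢
      push_cast [h]
      linear_combination this
  · rw [map_sub, coeff_C_mul, coeff_C_mul, terminatingSeries, coeff_mk, coeff_mk, gaussCoeff_zero,
      leadCoeff_natCast h]
    simp [terminatingCoeff]

theorem reducedGauss_natCast {n m : ℕ} (h : m ≤ n) {w : ℂ} (hw : w ∈ cutPlane) :
    reducedGauss m n w = (-1) ^ m * (terminatingPoly m (n - m) (n + m)).eval w := by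
  have h1 : AnalyticOnNhd ℂ (reducedGauss m n) cutPlane :=
    ((differentiableOn_gaussCut m (paramProd m n)).const_mul _).analyticOnNhd isOpen_cutPlane
  have h2 : AnalyticOnNhd ℂ (fun w => (-1) ^ m * (terminatingPoly m (n - m) (n + m)).eval w)
      cutPlane :=
    ((Polynomial.differentiable _).const_mul _).differentiableOn.analyticOnNhd isOpen_cutPlane
  refine h1.eqOn_of_preconnected_of_eventuallyEq h2 isPreconnected_cutPlane
    (ball_subset_cutPlane (Metric.mem_ball_self one_pos)) ?_ hw
  filter_upwards [Metric.ball_mem_nhds (0 : ℂ) one_pos] with x hx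
  have hx' : ‖x‖ < 1 := by simpa using hx
  have e1 := ((hasPowerSum_gaussCut m (paramProd m n)).C_mul (leadCoeff m n)) x hx'
  have e2 := ((hasPowerSum_polynomial (terminatingPoly m (n - m) (n + m)) 1).C_mul ((-1) ^ m)) x hx'
  rw [C_leadCoeff_mul_mk_gaussCoeff h] at e1
  rw [coe_terminatingPoly] at e2
  exact e1.unique e2

/-- Both sides are holomorphic on the connected cut plane. Near 0 they have the same power series:
the series of the left side satisfies the Gauss equation differentiated in ν, where dσ/dν = -(2n +
1) at ν = n. -/
theorem one_sub_pow_mul_reducedGaussDeriv {n m : ℕ} (h : m ≤ n) {w : ℂ} (hw : w ∈ cutPlane) :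
    (1 - w) ^ m * reducedGaussDeriv n m w
      = (legendrePoly n m).eval w * Complex.log (1 - w) + (degreeDerivPoly n m).eval w := by
  have hlog : DifferentiableOn ℂ (fun w : ℂ => Complex.log (1 - w)) cutPlane := fun w hw =>
    ((differentiableAt_id.const_sub (1 : ℂ)).clog hw).differentiableWithinAt
  have h1 : AnalyticOnNhd ℂ (fun w => (1 - w) ^ m * reducedGaussDeriv n m w) cutPlane := by
    refine DifferentiableOn.analyticOnNhd ?_ isOpen_cutPlane
    refine ((differentiableOn_id.const_sub 1).pow m).mul ?_
    exact ((differentiableOn_gaussCut m _).const_mul _).add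
      ((differentiableOn_gaussCutDeriv m _).const_mul _)
  have h2 : AnalyticOnNhd ℂ (fun w => (legendrePoly n m).eval w * Complex.log (1 - w)
      + (degreeDerivPoly n m).eval w) cutPlane :=
    (((Polynomial.differentiable _).differentiableOn.mul hlog).add
      (Polynomial.differentiable _).differentiableOn).analyticOnNhd isOpen_cutPlane
  refine h1.eqOn_of_preconnected_of_eventuallyEq h2 isPreconnected_cutPlane
    (ball_subset_cutPlane (Metric.mem_ball_self one_pos)) ?_ hw
  obtain ⟨R, hR, hφ'⟩ := exists_hasPowerSum_gaussCutDeriv m (paramProd m n)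
  set t : PowerSeries ℂ := C (leadCoeff m n * (natDigamma (n + m) - natDigamma (n - m)))
      * mk (gaussCoeff m (paramProd m n))
    + C (-(2 * n + 1) * leadCoeff m n)
      * mk fun k => deriv (fun s => gaussCoeff m s k) (paramProd m n) with ht
  have key : (1 - X) ^ m * t = legendreSeries n m * logOneSubSeries + degreeDerivSeries n m := by
    refine one_sub_X_pow_mul_eq h (K := C (leadCoeff m n) * mk (gaussCoeff m (paramProd m n)))
      ?_ ?_ ?_
    · rw [C_leadCoeff_mul_mk_gaussCoeff h, legendreSeries]
      ring
    · ext k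
      have e1 := gaussCoeff_succ m (paramProd m n) k
      have e2 := deriv_gaussCoeff_succ m (paramProd m n) k
      rw [coeff_hgOp, ht, map_add, map_add]
      simp only [coeff_C_mul, coeff_mk]
      generalize deriv (fun s => gaussCoeff m s k) (paramProd m n) = d0 at *
      generalize deriv (fun s => gaussCoeff m s (k + 1)) (paramProd m n) = d1 at *
      generalize gaussCoeff m (paramProd m n) k = c0 at *
      generalize gaussCoeff m (paramProd m n) (k + 1) = c1 at *
      rw [paramProd] at e1 e2
      push_cast [h]
      linear_combination leadCoeff m n * (natDigamma (n + m) - natDigamma (n - m)) * e1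
        - (2 * n + 1) * leadCoeff m n * e2
    · rw [coeff_zero_degreeDerivSeries, ht, map_add, coeff_C_mul, coeff_C_mul, coeff_mk, coeff_mk,
        deriv_gaussCoeff_zero, gaussCoeff_zero, leadCoeff_natCast h]
      ring
  filter_upwards [Metric.ball_mem_nhds (0 : ℂ) (lt_min hR one_pos)] with x hx
  have hx' : ‖x‖ < min R 1 := by simpa using hx
  have hxR := hx'.trans_le (min_le_left _ _)
  have hx1 := hx'.trans_le (min_le_right _ _)
  have htx : HasPowerSum t (min R 1) (reducedGaussDeriv n m) :=
    (((hasPowerSum_gaussCut m (paramProd m n)).mono (min_le_right _ _)).C_mul _).add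
      ((hφ'.mono (min_le_left _ _)).C_mul _)
  have e1 := (htx.poly_mul ((1 - .X) ^ m)) x hx'
  have e2 := ((hasPowerSum_logOneSubSeries.poly_mul (legendrePoly n m)).add
    (hasPowerSum_polynomial (degreeDerivPoly n m) 1)) x hx1
  rw [coe_legendrePoly, coe_degreeDerivPoly, ← key] at e2
  simp only [Polynomial.coe_pow, Polynomial.coe_sub, Polynomial.coe_one, Polynomial.coe_X,
    Polynomial.eval_pow, Polynomial.eval_sub, Polynomial.eval_one, Polynomial.eval_X] at e1
  exact e1.unique e2

end

/-! ### Principal powers on the Legendre domain, and the parity of P_n^m -/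

section

/-- The plane cut along `(-∞, 1]`. -/
def legendreDomain : Set ℂ := {z : ℂ | z.im ≠ 0 ∨ 1 < z.re}

theorem isOpen_legendreDomain : IsOpen legendreDomain :=
  (isOpen_ne_fun Complex.continuous_im continuous_const).union
    (isOpen_lt continuous_const Complex.continuous_re)

variable {z : ℂ}

theorem sub_one_div_two_mem_slitPlane (hz : z ∈ legendreDomain) :
    (z - 1) / 2 ∈ Complex.slitPlane := by
  rw [Complex.mem_slitPlane_iff]
  rcases hz with h | h
  · right; simpa using h
  · left; simpa using h

theorem add_one_div_two_mem_slitPlane (hz : z ∈ legendreDomain) :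
    (z + 1) / 2 ∈ Complex.slitPlane := by
  rw [Complex.mem_slitPlane_iff]
  rcases hz with h | h
  · right; simpa using h
  · left
    simp
    linarith

theorem sub_one_ne_zero' (hz : z ∈ legendreDomain) : z - 1 ≠ 0 := fun h =>
  Complex.slitPlane_ne_zero (sub_one_div_two_mem_slitPlane hz) (by simp [h])

theorem add_one_ne_zero' (hz : z ∈ legendreDomain) : z + 1 ≠ 0 := fun h =>
  Complex.slitPlane_ne_zero (add_one_div_two_mem_slitPlane hz) (by simp [h])

theorem one_sub_div_two_mem_cutPlane (hz : z ∈ legendreDomain) : (1 - z) / 2 ∈ cutPlane := by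
  have := add_one_div_two_mem_slitPlane hz
  rwa [show (z + 1) / 2 = 1 - (1 - z) / 2 by ring] at this

/-- The numbers z + 1 and z - 1 lie in the same closed half-plane, so their arguments share a sign
and have absolute value below π. Hence the principal logarithm of the quotient is the difference of
the logarithms. -/
theorem arg_sub_arg_mem_Ioo (hz : z ∈ legendreDomain) :
    Complex.arg ((z + 1) / 2) - Complex.arg ((z - 1) / 2) ∈ Set.Ioo (-Real.pi) Real.pi := by
  have ha := Complex.mem_slitPlane_iff_arg.1 (add_one_div_two_mem_slitPlane hz)
  have hb := Complex.mem_slitPlane_iff_arg.1 (sub_one_div_two_mem_slitPlane hz)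
  have ha' := lt_of_le_of_ne (Complex.arg_le_pi _) ha.1
  have hb' := lt_of_le_of_ne (Complex.arg_le_pi _) hb.1
  have ha'' := Complex.neg_pi_lt_arg ((z + 1) / 2)
  have hb'' := Complex.neg_pi_lt_arg ((z - 1) / 2)
  rcases lt_or_ge z.im 0 with h | h
  · have h1 : Complex.arg ((z + 1) / 2) < 0 := Complex.arg_neg_iff.2 (by simpa using by linarith)
    have h2 : Complex.arg ((z - 1) / 2) < 0 := Complex.arg_neg_iff.2 (by simpa using by linarith)
    constructor <;> linarith
  · have h1 : 0 ≤ Complex.arg ((z + 1) / 2) := Complex.arg_nonneg_iff.2 (by simp; linarith)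
    have h2 : 0 ≤ Complex.arg ((z - 1) / 2) := Complex.arg_nonneg_iff.2 (by simp; linarith)
    constructor <;> linarith

theorem log_quotient (hz : z ∈ legendreDomain) :
    Complex.log ((z + 1) / (z - 1)) = Complex.log ((z + 1) / 2) - Complex.log ((z - 1) / 2) := by
  have h := arg_sub_arg_mem_Ioo hz
  have h1 := sub_one_ne_zero' hz
  rw [← Complex.log_exp (x := Complex.log ((z + 1) / 2) - Complex.log ((z - 1) / 2))
    (by simpa [Complex.log_im] using h.1) (by simpa [Complex.log_im] using h.2.le), Complex.exp_sub,
    Complex.exp_log (Complex.slitPlane_ne_zero (add_one_div_two_mem_slitPlane hz)),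
    Complex.exp_log (Complex.slitPlane_ne_zero (sub_one_div_two_mem_slitPlane hz))]
  congr 1
  field_simp

theorem quotient_mem_slitPlane (hz : z ∈ legendreDomain) :
    (z + 1) / (z - 1) ∈ Complex.slitPlane := by
  rw [Complex.mem_slitPlane_iff_arg]
  refine ⟨?_, div_ne_zero (add_one_ne_zero' hz) (sub_one_ne_zero' hz)⟩
  rw [← Complex.log_im, log_quotient hz, Complex.sub_im, Complex.log_im, Complex.log_im]
  exact (arg_sub_arg_mem_Ioo hz).2.ne

theorem inv_quotient_mem_slitPlane (hz : z ∈ legendreDomain) :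
    (z - 1) / (z + 1) ∈ Complex.slitPlane := by
  have h := quotient_mem_slitPlane hz
  rw [Complex.mem_slitPlane_iff_arg] at h ⊢
  rw [← inv_div, ne_eq, Complex.arg_inv, if_neg h.1]
  refine ⟨fun h' => ?_, inv_ne_zero h.2⟩
  linarith [Complex.neg_pi_lt_arg ((z + 1) / (z - 1)), Complex.arg_le_pi ((z + 1) / (z - 1))]

/-- The power `((z + 1) / (z - 1)) ^ (m / 2)`. -/
noncomputable def halfPower (m : ℕ) (z : ℂ) : ℂ := ((z + 1) / (z - 1)) ^ ((m : ℂ) / 2)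

theorem halfPower_ne_zero (m : ℕ) (hz : z ∈ legendreDomain) : halfPower m z ≠ 0 := by
  rw [halfPower, Complex.cpow_def_of_ne_zero (Complex.slitPlane_ne_zero (quotient_mem_slitPlane hz))]
  exact Complex.exp_ne_zero _

theorem inv_quotient_cpow (m : ℕ) (hz : z ∈ legendreDomain) :
    ((z - 1) / (z + 1)) ^ ((m : ℂ) / 2) = (halfPower m z)⁻¹ := by
  rw [halfPower, ← Complex.inv_cpow _ _
    (Complex.mem_slitPlane_iff_arg.1 (quotient_mem_slitPlane hz)).1, inv_div]

theorem halfPower_neg (m : ℕ) (hz : z ∈ legendreDomain) : halfPower m (-z) = (halfPower m z)⁻¹ := by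
  rw [← inv_quotient_cpow m hz, halfPower, ← neg_div_neg_eq]
  congr 2 <;> ring

/-- This relation trades powers of (1 - z)/2 for powers of (1 + z)/2 and thereby links the formulas
at z and at -z. -/
theorem halfPower_sq_mul (m : ℕ) (hz : z ∈ legendreDomain) :
    halfPower m z ^ 2 * ((1 - z) / 2) ^ m = (-1) ^ m * ((1 + z) / 2) ^ m := by
  have h : halfPower m z ^ 2 = ((z + 1) / (z - 1)) ^ m := by
    rw [halfPower, ← Complex.cpow_nat_mul, ← Complex.cpow_natCast]
    congr 1
    push_cast
    ring
  rw [h, ← mul_pow, ← mul_pow]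
  congr 1
  have := sub_one_ne_zero' hz
  field_simp
  ring

theorem cpow_mul_cpow_eq (m : ℕ) (hz : z ∈ legendreDomain) :
    ((z - 1) / 2) ^ ((m : ℂ) / 2) * ((z + 1) / 2) ^ ((m : ℂ) / 2)
      = halfPower m z * ((z - 1) / 2) ^ m := by
  have h1 := Complex.slitPlane_ne_zero (add_one_div_two_mem_slitPlane hz)
  have h2 := Complex.slitPlane_ne_zero (sub_one_div_two_mem_slitPlane hz)
  have h3 := Complex.slitPlane_ne_zero (quotient_mem_slitPlane hz)
  rw [halfPower, ← Complex.cpow_natCast ((z - 1) / 2) m, Complex.cpow_def_of_ne_zero h1,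
    Complex.cpow_def_of_ne_zero h2, Complex.cpow_def_of_ne_zero h2, Complex.cpow_def_of_ne_zero h3,
    ← Complex.exp_add, ← Complex.exp_add, log_quotient hz]
  congr 1
  ring

theorem hobsonP_eq (m : ℕ) (ν : ℂ) (hz : z ∈ legendreDomain) :
    hobsonP ν m z = halfPower m z * (((1 - z) / 2) ^ m * reducedGauss m ν ((1 - z) / 2)) := by
  rw [hobsonP, gaussRegularized_eq m ν (one_sub_div_two_mem_cutPlane hz), halfPower]

/-- The derivative of `P_ν^m(z)` with respect to `ν`, at `ν = n`. -/
noncomputable def hobsonPDeriv (n m : ℕ) (z : ℂ) : ℂ :=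
  halfPower m z * (((1 - z) / 2) ^ m * reducedGaussDeriv n m ((1 - z) / 2))

variable {n m : ℕ}

theorem hasDerivAt_hobsonP (h : m ≤ n) (hz : z ∈ legendreDomain) :
    HasDerivAt (fun ν => hobsonP ν m z) (hobsonPDeriv n m z) n := by
  simp only [hobsonP_eq m _ hz]
  exact ((hasDerivAt_reducedGauss h (one_sub_div_two_mem_cutPlane hz)).const_mul _).const_mul _

theorem eval_polyOfCoeff (N : ℕ) (y : ℕ → ℂ) (x : ℂ) :
    (polyOfCoeff N y).eval x = ∑ k ∈ Finset.range (N + 1), y k * x ^ k := by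
  simp [polyOfCoeff, Polynomial.eval_finsetSum]

theorem eval_reflected (h : m ≤ n) (x : ℂ) :
    (polyOfCoeff n (reflectedCoeff n m)).eval x
      = x ^ m * (terminatingPoly m (n - m) (n + m)).eval x := by
  rw [terminatingPoly, eval_polyOfCoeff, eval_polyOfCoeff, show n + 1 = m + (n - m + 1) by omega,
    Finset.sum_range_add, Finset.sum_eq_zero, zero_add, Finset.mul_sum]
  · refine Finset.sum_congr rfl fun k _ => ?_
    rw [reflectedCoeff, if_neg (by omega), Nat.add_sub_cancel_left]
    ring
  · intro k hk
    rw [reflectedCoeff, if_pos (Finset.mem_range.1 hk), zero_mul]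

/-- The finite sum over `k < m` in the representation of `Q_n^m`, as a function of `(1 - z) / 2`. -/
noncomputable def finiteSum (n m : ℕ) (x : ℂ) : ℂ :=
  ∑ k ∈ Finset.range m,
    (((k + n).factorial * (m - k - 1).factorial : ℂ) / (k.factorial * (n - k).factorial)) * x ^ k

/-- The polynomial with the coefficients of `terminatingPoly` weighted by `ψ (k + m + 1) + ψ (k + 1)`. -/
noncomputable def denominatorDigammaPoly (n m : ℕ) : Polynomial ℂ :=
  polyOfCoeff (n - m) fun k =>
    terminatingCoeff m (n - m) (n + m) k * (natDigamma (k + m) + natDigamma k)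

theorem eval_reflectedDeriv (h : m ≤ n) (x : ℂ) :
    (polyOfCoeff n (reflectedDerivCoeff n m)).eval x
      = -finiteSum n m x + x ^ m * (2 * (terminatingDigammaPoly m (n - m) (n + m)).eval x
        - (denominatorDigammaPoly n m).eval x) := by
  rw [terminatingDigammaPoly, denominatorDigammaPoly, eval_polyOfCoeff, eval_polyOfCoeff,
    eval_polyOfCoeff, show n + 1 = m + (n - m + 1) by omega,
    Finset.sum_range_add, finiteSum, ← Finset.sum_neg_distrib]
  congr 1
  · refine Finset.sum_congr rfl fun k hk => ?_
    rw [reflectedDerivCoeff, if_pos (Finset.mem_range.1 hk)]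
    ring
  · rw [Finset.mul_sum, ← Finset.sum_sub_distrib, Finset.mul_sum]
    refine Finset.sum_congr rfl fun k _ => ?_
    rw [reflectedDerivCoeff, if_neg (by omega), Nat.add_sub_cancel_left,
      show m + k + n = k + (n + m) by ring, show m + k = k + m by ring]
    ring

theorem eval_terminatingPoly_reflect (h : m ≤ n) (x : ℂ) :
    (-1) ^ m * (1 - x) ^ m * (terminatingPoly m (n - m) (n + m)).eval x
      = (-1) ^ n * (1 - x) ^ m * (terminatingPoly m (n - m) (n + m)).eval (1 - x) := by
  have := congrArg (fun p => Polynomial.eval x p) (legendrePoly_eq_comp h)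
  simp only [legendrePoly, Polynomial.eval_mul, Polynomial.eval_C, Polynomial.eval_pow,
    Polynomial.eval_sub, Polynomial.eval_one, Polynomial.eval_X, Polynomial.eval_comp,
    eval_reflected h] at this
  linear_combination this

theorem neg_mem_legendreDomain (hz : z.im ≠ 0) : -z ∈ legendreDomain := Or.inl (by simpa using hz)

theorem hobsonP_natCast (h : m ≤ n) (hz : z ∈ legendreDomain) :
    hobsonP n m z = (-1) ^ m * halfPower m z * ((1 - z) / 2) ^ m
      * (terminatingPoly m (n - m) (n + m)).eval ((1 - z) / 2) := by
  rw [hobsonP_eq m _ hz, reducedGauss_natCast h (one_sub_div_two_mem_cutPlane hz)]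
  ring

/-- The replacement z ↦ -z is w ↦ 1 - w. The two expansions of the polynomial solution give the sign
(-1)^n, and the half power is inverted. -/
theorem hobsonP_neg (h : m ≤ n) (hz : z.im ≠ 0) :
    hobsonP n m (-z) = (-1) ^ n * hobsonP n m z := by
  have hz' : z ∈ legendreDomain := Or.inl hz
  have hc := halfPower_ne_zero m hz'
  have hsq := halfPower_sq_mul m hz'
  have hr := eval_terminatingPoly_reflect h ((1 - z) / 2)
  have hn : ((-1 : ℂ) ^ n * (-1) ^ n) = 1 := by rw [← mul_pow]; simp
  rw [show 1 - (1 - z) / 2 = (1 + z) / 2 by ring] at hr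
  rw [hobsonP_natCast h hz', hobsonP_natCast h (neg_mem_legendreDomain hz), halfPower_neg m hz',
    sub_neg_eq_add]
  have hcc := mul_inv_cancel₀ hc
  apply mul_left_cancel₀ hc
  generalize (terminatingPoly m (n - m) (n + m)).eval ((1 + z) / 2) = a' at *
  generalize (terminatingPoly m (n - m) (n + m)).eval ((1 - z) / 2) = a at *
  generalize ((1 + z) / 2) ^ m = U at *
  generalize (-1 : ℂ) ^ m = x at *
  generalize (-1 : ℂ) ^ n = y at *
  linear_combination x * U * a' * hcc - y * x * a * hsq - x * y * hr - x * U * a' * hn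

end

/-! ### The limit in the degree, and the closed form with a sign parameter -/

section

variable {z : ℂ} {n m : ℕ}

/-- The limit of `hobsonQGeneric ν m z` for `ν → n`. -/
noncomputable def hobsonQLim (n m : ℕ) (z : ℂ) : ℂ :=
  (if 0 < z.im then -1 else 1) * Complex.I * Real.pi / 2 * hobsonP n m z
    + 1 / 2 * hobsonPDeriv n m z - (-1) ^ n / 2 * hobsonPDeriv n m (-z)

theorem exp_I_pi_mul_natCast (n : ℕ) {s : ℂ} (hs : s = -1 ∨ s = 1) :
    Complex.exp (s * Complex.I * Real.pi * n) = (-1) ^ n := by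
  have h : Complex.exp (s * Complex.I * Real.pi) = -1 := by
    rcases hs with rfl | rfl
    · rw [show -1 * Complex.I * Real.pi = -(Real.pi * Complex.I) by ring, Complex.exp_neg,
        Complex.exp_pi_mul_I]
      norm_num
    · rw [show 1 * Complex.I * Real.pi = Real.pi * Complex.I by ring, Complex.exp_pi_mul_I]
  rw [mul_comm, Complex.exp_nat_mul, h]

theorem tendsto_div_nhdsNE {f g : ℂ → ℂ} {a f' g' : ℂ} (hf : HasDerivAt f f' a)
    (hg : HasDerivAt g g' a) (hfa : f a = 0) (hga : g a = 0) (hg' : g' ≠ 0) :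
    Tendsto (fun x => f x / g x) (𝓝[≠] a) (𝓝 (f' / g')) := by
  refine (hf.tendsto_slope.div hg.tendsto_slope hg').congr' ?_
  filter_upwards [self_mem_nhdsWithin] with x hx
  have : x - a ≠ 0 := sub_ne_zero.2 hx
  simp only [slope_def_field, hfa, hga, sub_zero, Pi.div_apply]
  field_simp

/-- L'Hôpital's rule: parity makes the numerator vanish at n, and the derivative π(-1)^(n + m) of
the sine is nonzero. -/
theorem tendsto_hobsonQGeneric (h : m ≤ n) (hz : z.im ≠ 0) :
    Tendsto (fun ν : ℂ => hobsonQGeneric ν m z) (𝓝[≠] (n : ℂ)) (𝓝 (hobsonQLim n m z)) := by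
  set s : ℂ := if 0 < z.im then -1 else 1 with hs
  have hs' : s = -1 ∨ s = 1 := by
    rw [hs]; split_ifs <;> simp
  have hn : ((-1 : ℂ) ^ n * (-1) ^ n) = 1 := by rw [← mul_pow]; simp
  have hπ : (Real.pi : ℂ) ≠ 0 := by exact_mod_cast Real.pi_ne_zero
  have hexp : HasDerivAt (fun ν : ℂ => Complex.exp (s * Complex.I * Real.pi * ν))
      ((-1) ^ n * (s * Complex.I * Real.pi)) n := by
    have := ((hasDerivAt_id (n : ℂ)).const_mul (s * Complex.I * Real.pi)).cexp
    simpa [exp_I_pi_mul_natCast n hs'] using this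
  have hnum := (((hexp.mul (hasDerivAt_hobsonP h (Or.inl hz : z ∈ legendreDomain))).sub
    (hasDerivAt_hobsonP h (neg_mem_legendreDomain hz))).const_mul
      ((Real.pi / 2 : ℂ) * Complex.exp (Complex.I * Real.pi * m)))
  have hden : HasDerivAt (fun ν : ℂ => Complex.sin (Real.pi * (ν + m)))
      (Real.pi * (-1) ^ (n + m)) n := by
    have := (((hasDerivAt_id (n : ℂ)).add_const (m : ℂ)).const_mul (Real.pi : ℂ)).csin
    refine this.congr_deriv ?_
    have hc : Complex.cos (Real.pi * ((n : ℂ) + m)) = (-1) ^ (n + m) := by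
      have := Real.cos_nat_mul_pi (n + m)
      rw [mul_comm]
      exact_mod_cast this
    simp only [id, hc]
    ring
  have hlim := tendsto_div_nhdsNE hnum hden ?_ ?_ ?_
  · have e1 := exp_I_pi_mul_natCast n hs'
    have e2 := exp_I_pi_mul_natCast m (s := 1) (Or.inr rfl)
    rw [one_mul] at e2
    have hval : hobsonQLim n m z = Real.pi / 2 * (-1) ^ m *
        ((-1) ^ n * (s * Complex.I * Real.pi) * hobsonP n m z + (-1) ^ n * hobsonPDeriv n m z
          - hobsonPDeriv n m (-z)) / (Real.pi * (-1) ^ (n + m)) := by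
      rw [eq_div_iff (mul_ne_zero hπ (pow_ne_zero _ (by norm_num))), hobsonQLim, ← hs, pow_add]
      linear_combination -(Real.pi * (-1) ^ m * hobsonPDeriv n m (-z) / 2) * hn
    rw [e1] at hlim
    rw [hval, ← e2]
    exact hlim
  · have e1 := exp_I_pi_mul_natCast n hs'
    simp only [Pi.sub_apply, Pi.mul_apply, e1, hobsonP_neg h hz]
    ring
  · have := Complex.sin_nat_mul_pi (n + m)
    rw [← this]
    push_cast
    ring_nf
  · exact mul_ne_zero hπ (pow_ne_zero _ (by norm_num))

/-- The right-hand side of the representation of `Q_n^m`, with the upper signs for `ε = 1` and the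
lower signs for `ε = -1`. -/
noncomputable def hobsonQRep (n m : ℕ) (ε z : ℂ) : ℂ :=
  1 / 2 * hobsonP n m z * Complex.log ((z + 1) / (z - 1))
    - ε * (1 / 2) * (Complex.digamma (n + 1) + Complex.digamma (n - m + 1)) * hobsonP n m z
    + ε * (ε ^ n * (-1) ^ m / 2) * ((z + ε) / (z - ε)) ^ ((m : ℂ) / 2) *
      ∑ k ∈ Finset.range m, (-ε) ^ k *
        (((k + n).factorial * (m - k - 1).factorial : ℂ) /
          (k.factorial * (n - k).factorial)) * ((z - ε) / 2) ^ k
    - ε * (ε ^ (n + m) / 2) *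
      (((z - 1) / 2) ^ ((m : ℂ) / 2) * ((z + 1) / 2) ^ ((m : ℂ) / 2)) *
      ∑ k ∈ Finset.range (n - m + 1), ε ^ k *
        (((k + n + m).factorial : ℂ) /
          (k.factorial * (k + m).factorial * (n - m - k).factorial)) *
        (Complex.digamma (k + n + m + 1) - Complex.digamma (k + m + 1)
          - Complex.digamma (k + 1)) * ((z - ε) / 2) ^ k
    + ε * (ε ^ n / 2) * ((n + m).factorial / (n - m).factorial) *
      ((z - ε) / (z + ε)) ^ ((m : ℂ) / 2) *
      ∑ k ∈ Finset.range (n + 1), ε ^ k *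
        (((k + n).factorial : ℂ) * Complex.digamma (k + n + 1) /
          (k.factorial * (k + m).factorial * (n - k).factorial)) * ((z - ε) / 2) ^ k

theorem sum_finiteSum (n m : ℕ) (z : ℂ) :
    ∑ k ∈ Finset.range m, (-1) ^ k *
        (((k + n).factorial * (m - k - 1).factorial : ℂ) /
          (k.factorial * (n - k).factorial)) * ((z - 1) / 2) ^ k
      = finiteSum n m ((1 - z) / 2) := by
  refine Finset.sum_congr rfl fun k _ => ?_
  rw [show (1 - z) / 2 = -1 * ((z - 1) / 2) by ring, mul_pow]
  ring

theorem sum_digamma_difference (n m : ℕ) (z : ℂ) :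
    ∑ k ∈ Finset.range (n - m + 1), (((k + n + m).factorial : ℂ) /
          (k.factorial * (k + m).factorial * (n - m - k).factorial)) *
        (Complex.digamma (k + n + m + 1) - Complex.digamma (k + m + 1)
          - Complex.digamma (k + 1)) * ((z - 1) / 2) ^ k
      = (terminatingDigammaPoly m (n - m) (n + m)).eval ((1 - z) / 2)
        - (denominatorDigammaPoly n m).eval ((1 - z) / 2) := by
  rw [terminatingDigammaPoly, denominatorDigammaPoly, eval_polyOfCoeff, eval_polyOfCoeff,
    ← Finset.sum_sub_distrib]
  refine Finset.sum_congr rfl fun k hk => ?_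
  rw [terminatingCoeff, if_pos (Nat.lt_succ_iff.1 (Finset.mem_range.1 hk)),
    show (1 - z) / 2 = -1 * ((z - 1) / 2) by ring, mul_pow, natDigamma, natDigamma, natDigamma,
    ← add_assoc]
  have e : ((-1 : ℂ) ^ k * (-1) ^ k) = 1 := by rw [← mul_pow]; simp
  push_cast
  linear_combination -((((k + n + m).factorial : ℂ) /
          (k.factorial * (k + m).factorial * (n - m - k).factorial)) *
        (Complex.digamma (k + n + m + 1) - Complex.digamma (k + m + 1)
          - Complex.digamma (k + 1)) * ((z - 1) / 2) ^ k) * e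

theorem sum_terminatingDigammaPoly (n m : ℕ) (z : ℂ) :
    ∑ k ∈ Finset.range (n + 1), (((k + n).factorial : ℂ) * Complex.digamma (k + n + 1) /
          (k.factorial * (k + m).factorial * (n - k).factorial)) * ((z - 1) / 2) ^ k
      = (terminatingDigammaPoly m n n).eval ((1 - z) / 2) := by
  rw [terminatingDigammaPoly, eval_polyOfCoeff]
  refine Finset.sum_congr rfl fun k hk => ?_
  rw [terminatingCoeff, if_pos (Nat.lt_succ_iff.1 (Finset.mem_range.1 hk)),
    show (1 - z) / 2 = -1 * ((z - 1) / 2) by ring, mul_pow, natDigamma]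
  have e : ((-1 : ℂ) ^ k * (-1) ^ k) = 1 := by rw [← mul_pow]; simp
  push_cast
  linear_combination -(((k + n).factorial : ℂ) * Complex.digamma (k + n + 1) /
          (k.factorial * (k + m).factorial * (n - k).factorial) * ((z - 1) / 2) ^ k) * e

theorem hobsonQRep_one (h : m ≤ n) (hz : z ∈ legendreDomain) :
    hobsonQRep n m 1 z =
      1 / 2 * hobsonP n m z * Complex.log ((z + 1) / (z - 1))
      - 1 / 2 * (natDigamma n + natDigamma (n - m)) * hobsonP n m z
      + (-1) ^ m / 2 * halfPower m z * finiteSum n m ((1 - z) / 2)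
      - 1 / 2 * (halfPower m z * ((z - 1) / 2) ^ m) *
        ((terminatingDigammaPoly m (n - m) (n + m)).eval ((1 - z) / 2)
        - (denominatorDigammaPoly n m).eval ((1 - z) / 2))
      + 1 / 2 * ((n + m).factorial / (n - m).factorial) * (halfPower m z)⁻¹
        * (terminatingDigammaPoly m n n).eval ((1 - z) / 2) := by
  rw [hobsonQRep, ← sum_terminatingDigammaPoly, ← sum_digamma_difference, ← sum_finiteSum,
    inv_quotient_cpow m hz, cpow_mul_cpow_eq m hz, natDigamma, natDigamma, halfPower,
    Nat.cast_sub h]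
  simp only [one_pow, one_mul]

end

/-! ### The representation with the upper signs -/

section

variable {z : ℂ} {n m : ℕ}

theorem log_half_sub (hz : z.im ≠ 0) :
    Complex.log ((z - 1) / 2) = Complex.log ((1 - z) / 2)
      - (if 0 < z.im then -1 else 1) * Complex.I * Real.pi := by
  have e : (z - 1) / 2 = -((1 - z) / 2) := by ring
  have hn : ‖(z - 1) / 2‖ = ‖(1 - z) / 2‖ := by rw [e, norm_neg]
  rw [Complex.log, Complex.log, hn, e]
  split_ifs with h
  · rw [Complex.arg_neg_eq_arg_add_pi_of_im_neg (by simp; linarith)]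
    push_cast
    ring
  · have : z.im < 0 := lt_of_le_of_ne (not_lt.1 h) hz
    rw [Complex.arg_neg_eq_arg_sub_pi_of_im_pos (by simp; linarith)]
    push_cast
    ring

theorem pow_mul_reducedGaussDeriv_left (h : m ≤ n) {w : ℂ} (hw : w ∈ cutPlane) :
    (1 - w) ^ m * reducedGaussDeriv n m w = (-1) ^ m * ((1 - w) ^ m *
      ((terminatingPoly m (n - m) (n + m)).eval w
        * (Complex.log (1 - w) - (natDigamma n + natDigamma (n - m)))
        + (terminatingDigammaPoly m (n - m) (n + m)).eval w)
      + ((n + m).factorial / (n - m).factorial : ℂ) * (terminatingDigammaPoly m n n).eval w) := by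
  rw [one_sub_pow_mul_reducedGaussDeriv h hw]
  simp only [degreeDerivPoly, legendrePoly, Polynomial.eval_mul, Polynomial.eval_C,
    Polynomial.eval_pow, Polynomial.eval_sub, Polynomial.eval_one, Polynomial.eval_X,
    Polynomial.eval_add]
  ring

/-- The form for the point -z: there 1 - w equals (1 - z)/2, the variable of the expansion at z. -/
theorem pow_mul_reducedGaussDeriv_right (h : m ≤ n) {w : ℂ} (hw : w ∈ cutPlane) :
    (1 - w) ^ m * reducedGaussDeriv n m w = (-1) ^ n * ((1 - w) ^ m *
      ((terminatingPoly m (n - m) (n + m)).eval (1 - w) * Complex.log (1 - w)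
        + 2 * (terminatingDigammaPoly m (n - m) (n + m)).eval (1 - w)
        - (denominatorDigammaPoly n m).eval (1 - w))
      - finiteSum n m (1 - w)) := by
  rw [one_sub_pow_mul_reducedGaussDeriv h hw, legendrePoly_eq_comp h, degreeDerivPoly_eq_comp h]
  simp only [Polynomial.eval_mul, Polynomial.eval_C, Polynomial.eval_sub, Polynomial.eval_one,
    Polynomial.eval_X, Polynomial.eval_comp, eval_reflected h, eval_reflectedDeriv h]
  ring

/-- Half of the digamma sum from Ṗ(z) minus half of twice that sum from Ṗ(-z) leaves minus one half,
which yields ψ(k + n + m + 1) - ψ(k + m + 1) - ψ(k + 1). The finite sum over k < m comes from Ṗ(-z)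
alone, the last sum from Ṗ(z) alone. -/
theorem hobsonQLim_eq_hobsonQRep (h : m ≤ n) (hz : z.im ≠ 0) :
    hobsonQLim n m z = hobsonQRep n m 1 z := by
  have hz' : z ∈ legendreDomain := Or.inl hz
  have hzn := neg_mem_legendreDomain hz
  have hc := halfPower_ne_zero m hz'
  have hsq := halfPower_sq_mul m hz'
  have hn : ((-1 : ℂ) ^ n * (-1) ^ n) = 1 := by rw [← mul_pow]; simp
  have hm : ((-1 : ℂ) ^ m * (-1) ^ m) = 1 := by rw [← mul_pow]; simp
  have hw := one_sub_div_two_mem_cutPlane hz'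
  have hu := one_sub_div_two_mem_cutPlane hzn
  have hl := pow_mul_reducedGaussDeriv_left h hw
  have hr := pow_mul_reducedGaussDeriv_right h hu
  have hU : ((1 + z) / 2) ^ m ≠ 0 := pow_ne_zero _ (by
    rw [add_comm]; exact Complex.slitPlane_ne_zero (add_one_div_two_mem_slitPlane hz'))
  have hcc := mul_inv_cancel₀ hc
  rw [sub_neg_eq_add, show 1 - (1 + z) / 2 = (1 - z) / 2 by ring] at hr
  rw [show 1 - (1 - z) / 2 = (1 + z) / 2 by ring] at hl
  rw [hobsonQRep_one h hz', hobsonQLim, hobsonPDeriv, hobsonPDeriv, halfPower_neg m hz',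
    hobsonP_natCast h hz', log_quotient hz', log_half_sub hz,
    show (z - 1) / 2 = -1 * ((1 - z) / 2) by ring, mul_pow, sub_neg_eq_add, add_comm z 1]
  generalize (terminatingPoly m (n - m) (n + m)).eval ((1 - z) / 2) = a at *
  generalize (terminatingDigammaPoly m (n - m) (n + m)).eval ((1 - z) / 2) = a1 at *
  generalize (denominatorDigammaPoly n m).eval ((1 - z) / 2) = ap at *
  generalize (terminatingDigammaPoly m n n).eval ((1 - z) / 2) = b at *
  generalize finiteSum n m ((1 - z) / 2) = f at *
  generalize ((n + m).factorial / (n - m).factorial : ℂ) = M at *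
  generalize reducedGaussDeriv n m ((1 - z) / 2) = g at *
  generalize reducedGaussDeriv n m ((1 + z) / 2) = g' at *
  generalize ((1 + z) / 2) ^ m = U at *
  generalize ((1 - z) / 2) ^ m = W at *
  generalize Complex.log ((1 + z) / 2) = lu at *
  generalize Complex.log ((1 - z) / 2) = lw at *
  generalize (if 0 < z.im then (-1 : ℂ) else 1) = s at *
  generalize (-1 : ℂ) ^ m = x at *
  generalize (-1 : ℂ) ^ n = y at *
  generalize halfPower m z = c at *
  generalize natDigamma n + natDigamma (n - m) = d at *
  -- Division of `hl` by U = (1 - w)^m. In the last term c W / U becomes (-1)^m c⁻¹, by c^2 W =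
  -- (-1)^m U.
  have hD : c * (W * g) = x * c * W * (a * (lu - d) + a1) + c⁻¹ * M * b := by
    apply mul_left_cancel₀ hU
    apply mul_left_cancel₀ hc
    linear_combination c ^ 2 * W * hl + x * M * b * hsq + U * M * b * hm - U * M * b * hcc
  have hD' : c⁻¹ * (U * g') = y * x * c * (W * (a * lw + 2 * a1 - ap) - f) := by
    apply mul_left_cancel₀ hc
    linear_combination U * g' * hcc - x * g' * hsq - U * g' * hm + x * c ^ 2 * hr
  rw [hD, hD']
  linear_combination (-x * c * (W * (a * lw + 2 * a1 - ap) - f) / 2) * hn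

end

/-! ### The lower signs, and the passage to the real half-line -/

section

variable {z : ℂ} {n m : ℕ}

theorem log_quotient_neg (hz : z ∈ legendreDomain) :
    Complex.log ((-z + 1) / (-z - 1)) = -Complex.log ((z + 1) / (z - 1)) := by
  rw [← Complex.log_inv _ (Complex.mem_slitPlane_iff_arg.1 (quotient_mem_slitPlane hz)).1, inv_div,
    ← neg_div_neg_eq]
  congr 2 <;> ring

/-- Passing to -z turns the arguments of z + 1 and z - 1 by π in the same sense, so the two half
powers together contribute e^{±iπm}. -/
theorem cpow_mul_cpow_neg (m : ℕ) (hz : z.im ≠ 0) :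
    ((-z - 1) / 2) ^ ((m : ℂ) / 2) * ((-z + 1) / 2) ^ ((m : ℂ) / 2)
      = (-1) ^ m * (((z - 1) / 2) ^ ((m : ℂ) / 2) * ((z + 1) / 2) ^ ((m : ℂ) / 2)) := by
  have hz' : z ∈ legendreDomain := Or.inl hz
  have hcc := mul_inv_cancel₀ (halfPower_ne_zero m hz')
  have hm : ((-1 : ℂ) ^ m * (-1) ^ m) = 1 := by rw [← mul_pow]; simp
  have hsq := halfPower_sq_mul m hz'
  rw [cpow_mul_cpow_eq m hz', cpow_mul_cpow_eq m (neg_mem_legendreDomain hz), halfPower_neg m hz',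
    show (-z - 1) / 2 = -1 * ((1 + z) / 2) by ring, show (z - 1) / 2 = -1 * ((1 - z) / 2) by ring,
    mul_pow, mul_pow]
  generalize ((1 + z) / 2) ^ m = U at *
  generalize ((1 - z) / 2) ^ m = W at *
  generalize (-1 : ℂ) ^ m = x at *
  generalize halfPower m z = c at *
  linear_combination -c⁻¹ * hsq + c * W * hcc - c * W * hm

theorem neg_one_pow_mul_pow_neg (k : ℕ) (z : ℂ) :
    ((-z - 1) / 2) ^ k = (-1) ^ k * ((z + 1) / 2) ^ k := by
  rw [← mul_pow]
  congr 1
  ring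

theorem hobsonQRep_neg_one (h : m ≤ n) (hz : z.im ≠ 0) :
    hobsonQRep n m (-1) z = -(-1) ^ n * hobsonQRep n m 1 (-z) := by
  have hz' : z ∈ legendreDomain := Or.inl hz
  have hn : ((-1 : ℂ) ^ n * (-1) ^ n) = 1 := by rw [← mul_pow]; simp
  have e1 : (-z + 1) / (-z - 1) = (z - 1) / (z + 1) := by
    rw [← neg_div_neg_eq]; congr 1 <;> ring
  have e2 : (-z - 1) / (-z + 1) = (z + 1) / (z - 1) := by
    rw [← neg_div_neg_eq]; congr 1 <;> ring
  rw [hobsonQRep, hobsonQRep, log_quotient_neg hz', hobsonP_neg h hz, cpow_mul_cpow_neg m hz, e1,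
    e2, sub_neg_eq_add, ← sub_eq_add_neg, pow_add]
  simp only [neg_one_pow_mul_pow_neg, neg_neg, one_pow, one_mul]
  have s1 : ∑ k ∈ Finset.range m, (-1) ^ k *
        (((k + n).factorial * (m - k - 1).factorial : ℂ) /
          (k.factorial * (n - k).factorial)) * ((-1) ^ k * ((z + 1) / 2) ^ k)
      = ∑ k ∈ Finset.range m, (((k + n).factorial * (m - k - 1).factorial : ℂ) /
          (k.factorial * (n - k).factorial)) * ((z + 1) / 2) ^ k := by
    refine Finset.sum_congr rfl fun k _ => ?_
    have e : ((-1 : ℂ) ^ k * (-1) ^ k) = 1 := by rw [← mul_pow]; simp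
    linear_combination (((k + n).factorial * (m - k - 1).factorial : ℂ) /
          (k.factorial * (n - k).factorial)) * ((z + 1) / 2) ^ k * e
  have s2 (a : ℕ → ℂ) (N : ℕ) : ∑ k ∈ Finset.range N, a k * ((-1) ^ k * ((z + 1) / 2) ^ k)
      = ∑ k ∈ Finset.range N, (-1) ^ k * a k * ((z + 1) / 2) ^ k :=
    Finset.sum_congr rfl fun k _ => by ring
  rw [s1, s2, s2]
  simp only [← mul_assoc]
  linear_combination (-1 / 2 * hobsonP n m z * Complex.log ((z + 1) / (z - 1))
    - 1 / 2 * (Complex.digamma (n + 1) + Complex.digamma (n - m + 1)) * hobsonP n m z) * hn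

/-- The sign of Im z flips and the two degree derivatives change places. -/
theorem hobsonQLim_neg (h : m ≤ n) (hz : z.im ≠ 0) :
    hobsonQLim n m (-z) = -(-1) ^ n * hobsonQLim n m z := by
  have hn : ((-1 : ℂ) ^ n * (-1) ^ n) = 1 := by rw [← mul_pow]; simp
  have hs : (if 0 < (-z).im then (-1 : ℂ) else 1) = -(if 0 < z.im then -1 else 1) := by
    rcases lt_or_gt_of_ne hz with h0 | h0
    · rw [if_pos (by simpa using h0), if_neg h0.not_gt]
    · rw [if_neg (by simpa using h0.le), if_pos h0, neg_neg]
  rw [hobsonQLim, hobsonQLim, hs, hobsonP_neg h hz, neg_neg]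
  linear_combination (-hobsonPDeriv n m (-z) / 2) * hn

theorem hobsonQLim_eq_hobsonQRep_neg_one (h : m ≤ n) (hz : z.im ≠ 0) :
    hobsonQLim n m z = hobsonQRep n m (-1) z := by
  have hz' : (-z).im ≠ 0 := by simpa using hz
  have hn : ((-1 : ℂ) ^ n * (-1) ^ n) = 1 := by rw [← mul_pow]; simp
  rw [hobsonQRep_neg_one h hz, ← hobsonQLim_eq_hobsonQRep h hz', hobsonQLim_neg h hz]
  linear_combination -hobsonQLim n m z * hn

theorem continuousAt_hobsonP (h : m ≤ n) (hz : z ∈ legendreDomain) :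
    ContinuousAt (hobsonP n m) z := by
  have e : hobsonP n m =ᶠ[𝓝 z] fun z => (-1) ^ m * halfPower m z * ((1 - z) / 2) ^ m
      * (terminatingPoly m (n - m) (n + m)).eval ((1 - z) / 2) := by
    filter_upwards [isOpen_legendreDomain.mem_nhds hz] with w hw using hobsonP_natCast h hw
  refine ContinuousAt.congr ?_ e.symm
  have h1 : ContinuousAt (halfPower m) z :=
    ((continuousAt_id.add continuousAt_const).div (continuousAt_id.sub continuousAt_const)
      (sub_one_ne_zero' hz)).cpow continuousAt_const (quotient_mem_slitPlane hz)
  have h2 : Continuous fun z : ℂ => (1 - z) / 2 := by fun_prop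
  exact ((continuousAt_const.mul h1).mul (h2.pow m).continuousAt).mul
    ((Polynomial.continuous _).comp h2).continuousAt

theorem continuousAt_hobsonQRep (h : m ≤ n) {ε : ℂ} (hε : ε = 1 ∨ ε = -1)
    (hz : z ∈ legendreDomain) : ContinuousAt (hobsonQRep n m ε) z := by
  have hP := continuousAt_hobsonP h hz
  have hq : ContinuousAt (fun z : ℂ => (z + 1) / (z - 1)) z :=
    (continuousAt_id.add continuousAt_const).div (continuousAt_id.sub continuousAt_const)
      (sub_one_ne_zero' hz)
  have hi : ContinuousAt (fun z : ℂ => (z - 1) / (z + 1)) z :=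
    (continuousAt_id.sub continuousAt_const).div (continuousAt_id.add continuousAt_const)
      (add_one_ne_zero' hz)
  have hl := hq.clog (quotient_mem_slitPlane hz)
  have hq' := hq.cpow (continuousAt_const (y := (m : ℂ) / 2)) (quotient_mem_slitPlane hz)
  have hi' := hi.cpow (continuousAt_const (y := (m : ℂ) / 2)) (inv_quotient_mem_slitPlane hz)
  have ha : ContinuousAt (fun z : ℂ => ((z - 1) / 2) ^ ((m : ℂ) / 2)) z :=
    ((continuousAt_id.sub continuousAt_const).div_const 2).cpow continuousAt_const
      (sub_one_div_two_mem_slitPlane hz)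
  have hb : ContinuousAt (fun z : ℂ => ((z + 1) / 2) ^ ((m : ℂ) / 2)) z :=
    ((continuousAt_id.add continuousAt_const).div_const 2).cpow continuousAt_const
      (add_one_div_two_mem_slitPlane hz)
  have hs (N : ℕ) (a : ℕ → ℂ) :
      ContinuousAt (fun z : ℂ => ∑ k ∈ Finset.range N, a k * ((z - ε) / 2) ^ k) z :=
    Continuous.continuousAt (by fun_prop)
  have hu : ContinuousAt (fun z : ℂ => ((z + ε) / (z - ε)) ^ ((m : ℂ) / 2)) z := by
    rcases hε with rfl | rfl
    · exact hq'
    · simpa only [sub_neg_eq_add, ← sub_eq_add_neg] using hi'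
  have hv : ContinuousAt (fun z : ℂ => ((z - ε) / (z + ε)) ^ ((m : ℂ) / 2)) z := by
    rcases hε with rfl | rfl
    · exact hi'
    · simpa only [sub_neg_eq_add, ← sub_eq_add_neg] using hq'
  exact (((((continuousAt_const.mul hP).mul hl).sub (continuousAt_const.mul hP)).add
    ((continuousAt_const.mul hu).mul (hs _ _))).sub
    ((continuousAt_const.mul (ha.mul hb)).mul (hs _ _))).add
    ((continuousAt_const.mul hv).mul (hs _ _))

theorem hobsonQ_eq_hobsonQLim (h : m ≤ n) (hz : z.im ≠ 0) : hobsonQ n m z = hobsonQLim n m z := by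
  have hsin : Complex.sin (Real.pi * ((n : ℂ) + m)) = 0 := by
    rw [← Complex.sin_nat_mul_pi (n + m)]
    push_cast
    ring_nf
  rw [hobsonQ, if_neg hz, hobsonQOffAxis, if_pos hsin]
  exact (tendsto_hobsonQGeneric h hz).limUnder_eq

theorem nhdsWithin_im_ne_zero_neBot (z : ℂ) : (𝓝[{w : ℂ | w.im ≠ 0}] z).NeBot := by
  have hd : Dense {w : ℂ | w.im ≠ 0} := by
    have : {w : ℂ | w.im ≠ 0} = Complex.im ⁻¹' {0}ᶜ := rfl
    rw [this]
    exact (dense_compl_singleton (0 : ℝ)).preimage Complex.isOpenMap_im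
  exact mem_closure_iff_nhdsWithin_neBot.1 (hd z)

theorem hobsonQ_eq_hobsonQRep_one (h : m ≤ n) (hz : z ∈ legendreDomain) :
    hobsonQ n m z = hobsonQRep n m 1 z := by
  by_cases him : z.im = 0
  · have := nhdsWithin_im_ne_zero_neBot z
    rw [hobsonQ, if_pos him]
    refine Tendsto.limUnder_eq ?_
    refine ((continuousAt_hobsonQRep h (Or.inl rfl) hz).tendsto.mono_left
      nhdsWithin_le_nhds).congr' ?_
    filter_upwards [self_mem_nhdsWithin] with w hw
    rw [← hobsonQLim_eq_hobsonQRep h hw, ← hobsonQ_eq_hobsonQLim h hw, hobsonQ, if_neg hw]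
  · rw [hobsonQ_eq_hobsonQLim h him, hobsonQLim_eq_hobsonQRep h him]

theorem tendsto_hobsonQ (h : m ≤ n) (hz : z ∈ legendreDomain) :
    Tendsto (hobsonQ n m) (𝓝[{w : ℂ | w.im ≠ 0}] z) (𝓝 (hobsonQ n m z)) := by
  rw [hobsonQ_eq_hobsonQRep_one h hz]
  refine ((continuousAt_hobsonQRep h (Or.inl rfl) hz).tendsto.mono_left
    nhdsWithin_le_nhds).congr' ?_
  filter_upwards [self_mem_nhdsWithin] with w hw
  exact (hobsonQ_eq_hobsonQRep_one h (Or.inl hw)).symm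

/-- For the lower signs the formula is first available off the real axis only. On (1, ∞) both sides
are limits of the same off-axis values, and limits are unique because the off-axis points are dense.
-/
theorem hobsonQ_eq_hobsonQRep (h : m ≤ n) (hz : z ∈ legendreDomain) {ε : ℂ}
    (hε : ε = 1 ∨ ε = -1) : hobsonQ n m z = hobsonQRep n m ε z := by
  rcases hε with rfl | rfl
  · exact hobsonQ_eq_hobsonQRep_one h hz
  · have := nhdsWithin_im_ne_zero_neBot z
    refine tendsto_nhds_unique (tendsto_hobsonQ h hz)
      (((continuousAt_hobsonQRep h (Or.inr rfl) hz).tendsto.mono_left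
        nhdsWithin_le_nhds).congr' ?_)
    filter_upwards [self_mem_nhdsWithin] with w hw
    rw [hobsonQ_eq_hobsonQLim h hw, hobsonQLim_eq_hobsonQRep_neg_one h hw]

end

theorem mainTheorem8 (n m : ℕ) (hmn : m ≤ n) (z : ℂ) (hz : z.im ≠ 0 ∨ 1 < z.re) :
    -- the limits through which the value at integer degree and order is defined exist
    (z.im ≠ 0 → Tendsto (fun ν : ℂ => hobsonQGeneric ν m z) (𝓝[≠] (n : ℂ)) (𝓝 (hobsonQ n m z))) ∧
    Tendsto (hobsonQ n m) (𝓝[{w : ℂ | w.im ≠ 0}] z) (𝓝 (hobsonQ n m z)) ∧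
    -- the representation; `ε = 1` is the choice of upper signs, `ε = -1` that of lower signs
    ∀ ε : ℂ, ε = 1 ∨ ε = -1 →
      hobsonQ n m z =
        1 / 2 * hobsonP n m z * Complex.log ((z + 1) / (z - 1))
        - ε * (1 / 2) * (Complex.digamma (n + 1) + Complex.digamma (n - m + 1)) * hobsonP n m z
        + ε * (ε ^ n * (-1) ^ m / 2) * ((z + ε) / (z - ε)) ^ ((m : ℂ) / 2) *
          ∑ k ∈ Finset.range m, (-ε) ^ k *
            (((k + n).factorial * (m - k - 1).factorial : ℂ) /
              (k.factorial * (n - k).factorial)) * ((z - ε) / 2) ^ k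
        - ε * (ε ^ (n + m) / 2) *
          (((z - 1) / 2) ^ ((m : ℂ) / 2) * ((z + 1) / 2) ^ ((m : ℂ) / 2)) *
          ∑ k ∈ Finset.range (n - m + 1), ε ^ k *
            (((k + n + m).factorial : ℂ) /
              (k.factorial * (k + m).factorial * (n - m - k).factorial)) *
            (Complex.digamma (k + n + m + 1) - Complex.digamma (k + m + 1)
              - Complex.digamma (k + 1)) * ((z - ε) / 2) ^ k
        + ε * (ε ^ n / 2) * ((n + m).factorial / (n - m).factorial) *
          ((z - ε) / (z + ε)) ^ ((m : ℂ) / 2) *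
          ∑ k ∈ Finset.range (n + 1), ε ^ k *
            (((k + n).factorial : ℂ) * Complex.digamma (k + n + 1) /
              (k.factorial * (k + m).factorial * (n - k).factorial)) * ((z - ε) / 2) ^ k := by
  refine ⟨fun him => ?_, tendsto_hobsonQ hmn hz, fun ε hε => hobsonQ_eq_hobsonQRep hmn hz hε⟩
  rw [hobsonQ_eq_hobsonQLim hmn him]
  exact tendsto_hobsonQGeneric hmn him
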